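/- For metric spaces $(X,d_X)$, $(Y,d_Y)$ and $D\in[1,\infty)$, say that $f:X\to Y$ has distortion at most $D$ if there is $s\in(0,\infty)$ with $s\,d_X(x,y)\le d_Y(f(x),f(y))\le D s\,d_X(x,y)$ for all $x,y\in X$, and let $c_Y(X)\in[1,\infty]$ be the infimum of those $D$ for which a map $X\to Y$ of distortion at most $D$ exists ($c_Y(X)=\infty$ if there is none). For a real finite-dimensional Banach space $X$ with closed unit ball $B_X$ and $\delta>0$, a $\delta$-net in $B_X$ is a set $\mathcal N\subseteq B_X$ such that every point of $B_X$ is at distance at most $\delta$ from some point of $\mathcal N$. For a real Banach space $Y$ and $\varepsilon\in(0,1)$ let $\delta_{X\hookrightarrow Y}(\varepsilon)\in[0,1]$ be the supremum of those $\delta\in(0,1)$ such that every $\delta$-net $\mathcal N$ in $B_X$ satisfies $c_Y(\mathcal N)\ge(1-\varepsilon)c_Y(X)$ (the supremum of the empty set being $0$). **Theorem (Bourgain's discretization theorem).** There is a universal constant $C\in(0,\infty)$ such that for all real Banach spaces $X,Y$ with $\dim X=n<\infty$ the following hold. 1. If $\dim Y=\infty$, then for every $\varepsilon\in(0,1)$,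 $$\delta_{X\hookrightarrow Y}(\varepsilon)\ge \exp\left(-(n/\varepsilon)^{Cn}\right).$$ 2. For $Y$ of any dimension and every $\varepsilon\in(0,1)$, $$\delta_{X\hookrightarrow Y}(\varepsilon)\ge \exp\left(-(c_Y(X)/\varepsilon)^{Cn}\right),$$ where the right-hand side is $0$ if $c_Y(X)=\infty$. 3. For $Y$ of any dimension, let $\varepsilon\in(0,1/8)$, $D\in[1,\infty)$, and let $\delta>0$ satisfy $\delta\le\exp\left(-(D/\varepsilon)^{Cn}\right)$ or $\delta\le\exp\left(-(c_Y(X)/\varepsilon)^{Cn}\right)$. If some $\delta$-net in $B_X$ admits a map into $Y$ of distortion at most $D$, then there is a linear map $T:X\to Y$ of distortion at most $(1+12\varepsilon)D$; that is, for some $s>0$, $s\|x\|_X\le\|Tx\|_Y\le(1+12\varepsilon)Ds\|x\|_X$ for all $x\in X$. -/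

import Mathlib

open scoped ENNReal

universe u v

/-- The map `f` between metric spaces is a bi-Lipschitz embedding of distortion at most `D`:
for some scaling factor `s ∈ (0, ∞)`,
`s d(x, y) ≤ d(f x, f y) ≤ D s d(x, y)` for all `x, y`. -/
def HasDistortionLE {X : Type u} {Y : Type v} [MetricSpace X] [MetricSpace Y]
    (f : X → Y) (D : ℝ) : Prop :=
  ∃ s : ℝ, 0 < s ∧ ∀ x y : X,
    s * dist x y ≤ dist (f x) (f y) ∧ dist (f x) (f y) ≤ D * s * dist x y

/-- The distortion `c_Y(X) ∈ [1, ∞]` of the metric space `X` in the metric space `Y`: the infimum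
of those `D ≥ 1` for which `X` embeds into `Y` with distortion at most `D`, and `∞` if there is
no such finite `D` (the infimum of the empty set in `[0, ∞]` is `∞`). -/
noncomputable def distortion (X : Type u) (Y : Type v) [MetricSpace X] [MetricSpace Y] : ℝ≥0∞ :=
  sInf {c : ℝ≥0∞ | ∃ D : ℝ, 1 ≤ D ∧ (∃ f : X → Y, HasDistortionLE f D) ∧ c = ENNReal.ofReal D}

/-- `N` is a `δ`-net in the closed unit ball `B_X` of `X`: `N ⊆ B_X`, and every point of `B_X` is
at distance at most `δ` from a point of `N`. -/
def IsNetInUnitBall {X : Type u} [NormedAddCommGroup X] (δ : ℝ) (N : Set X) : Prop :=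
  N ⊆ Metric.closedBall 0 1 ∧ ∀ x ∈ Metric.closedBall (0 : X) 1, ∃ p ∈ N, dist x p ≤ δ

/-- The discretization modulus `δ_{X ↪ Y}(ε)`: the supremum (in `[0, 1]`, so `0` for the empty
set) of those `δ ∈ (0, 1)` for which every `δ`-net `N` in the unit ball of `X`, with the metric
induced from `X`, satisfies `c_Y(N) ≥ (1 - ε) c_Y(X)`. -/
noncomputable def discretizationModulus (X : Type u) (Y : Type v)
    [NormedAddCommGroup X] [NormedAddCommGroup Y] (ε : ℝ) : ℝ :=
  sSup {δ : ℝ | 0 < δ ∧ δ < 1 ∧ ∀ N : Set X, IsNetInUnitBall δ N →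
    ENNReal.ofReal (1 - ε) * distortion X Y ≤ distortion N Y}

/-- The quantity `exp (-(c / ε) ^ a) ∈ [0, 1]` for `c ∈ [0, ∞]`, with the convention
`exp (-∞) = 0`. -/
noncomputable def expNegBound (c : ℝ≥0∞) (ε a : ℝ) : ℝ≥0∞ :=
  EReal.exp (-(((c / ENNReal.ofReal ε) ^ a : ℝ≥0∞) : EReal))

/-! The argument is Bourgain's, with derivatives replaced by differences along a lattice and
smoothing by averages over lattice boxes. Rescaling the net by a huge `R` and rounding to it gives a
map `F` on `X` which, on the ball of radius `R`, satisfies `‖x - y‖ - 1 ≤ ‖F x - F y‖ ≤ D (‖x - y‖ +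
1)` (`exists_coarse_extension`). A linear map with nearly these bounds is sought among the discrete
derivatives of averages of `F`.

Let `F_j` be the successive averages of `F` over boxes of sides `K, …, K ^ j`. Upper bounds on
increments survive averaging; lower bounds need not. But the derivative commutes with averaging and
the norm is convex, so the norm of the derivative of `F_{j+1}` in a direction `a` is at most the box
average of the same quantity for `F_j`. Summed over a finite set of directions these quantities are
bounded, so they cannot drop by more than `1` at each of too many scales: at some scale and point
the loss is at most `1` (`exists_scale_stable`).

There the average before the loss is large: `F_j` stays within `O(K ^ j)` of `F`, so along segments
much longer than that, but much shorter than the next box, it still expands like `F`; telescoping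
bounds the average derivative from below (`le_boxAverage_norm_stepMap`). Hence the derivative at the
chosen point is bounded below in every chosen direction and above in all short lattice directions
(`exists_linearMap_of_coarse`). Taking as directions a net of the sphere, dilated and rounded to the
lattice, makes the additive errors relative errors of order `ε`
(`exists_linear_embedding_of_coarse`).

The number of scales is exponential in `n`, by the size of the sphere net, and `R` is a power of `K`
with about that exponent, hence the doubly exponential `δ`. The bounds on the modulus follow by
contradiction: a net embedding too well would give a linear map beating the distortion of `X`. -/

/-! ### Auerbach bases and nets of the sphere. -/

/-- **Auerbach's lemma**: a finite-dimensional normed space has a basis of vectors of norm at most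
`1` whose coordinate functionals have norm at most `1`. -/
theorem exists_auerbach_basis (X : Type*) [NormedAddCommGroup X] [NormedSpace ℝ X]
    [FiniteDimensional ℝ X] {n : ℕ} (hn : Module.finrank ℝ X = n) :
    ∃ e : Module.Basis (Fin n) ℝ X, (∀ i, ‖e i‖ ≤ 1) ∧ ∀ x i, |e.repr x i| ≤ ‖x‖ := by
  classical
  let b : Module.Basis (Fin n) ℝ X := Module.finBasisOfFinrankEq ℝ X hn
  have hcont : Continuous fun v : Fin n → X => b.det v := by
    simp only [Module.Basis.det_apply]
    refine Continuous.matrix_det (continuous_matrix fun i j => ?_)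
    exact ((b.coord i).continuous_of_finiteDimensional).comp (continuous_apply j)
  have hcpt : IsCompact (Set.univ.pi fun _ : Fin n => Metric.closedBall (0 : X) 1) :=
    isCompact_univ_pi fun _ => isCompact_closedBall _ _
  -- The basis is a maximizer of the absolute determinant over `n`-tuples in the unit ball.
  obtain ⟨v, hv, hmax⟩ := hcpt.exists_isMaxOn ⟨0, by simp [Set.mem_pi]⟩ hcont.abs.continuousOn
  have hv1 : ∀ i, ‖v i‖ ≤ 1 := fun i => by simpa using hv i (Set.mem_univ i)
  have hpos : 0 < |b.det v| := by
    let w : Fin n → X := fun i => (‖b i‖⁻¹ : ℝ) • b i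
    have hb : ∀ i, ‖b i‖ ≠ 0 := fun i => norm_ne_zero_iff.2 (b.ne_zero i)
    have hw : w ∈ Set.univ.pi fun _ : Fin n => Metric.closedBall (0 : X) 1 := by
      intro i _
      simp [w, norm_smul, inv_mul_cancel₀ (hb i)]
    have hdet : b.det w = ∏ i, (‖b i‖⁻¹ : ℝ) := by
      have := b.det.map_smul_univ (fun i => (‖b i‖⁻¹ : ℝ)) b
      simpa [w, b.det_self] using this
    have : 0 < |b.det w| := by
      rw [abs_pos, hdet]
      exact Finset.prod_ne_zero_iff.2 fun i _ => inv_ne_zero (hb i)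
    exact this.trans_le (hmax hw)
  have hunit : IsUnit (b.det v) := (abs_pos.1 hpos).isUnit
  obtain ⟨hli, hsp⟩ := (Module.Basis.is_basis_iff_det b).2 hunit
  refine ⟨Module.Basis.mk hli hsp.ge, fun i => by simpa using hv1 i, fun x i => ?_⟩
  have hkey : ∀ y : X, ‖y‖ ≤ 1 → |(Module.Basis.mk hli hsp.ge).repr y i| ≤ 1 := by
    intro y hy
    have h1 := congrArg (fun φ => φ y)
      (Module.Basis.det_smul_mk_coord_eq_det_update b hli hsp.ge i)
    -- Cramer's rule: putting `y` in place of `v i` multiplies the determinant by the `i`-th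
    -- coordinate of `y`, so maximality bounds that coordinate by `1`.
    have h2 : b.det v * (Module.Basis.mk hli hsp.ge).repr y i = b.det (Function.update v i y) := by
      simpa using h1
    have hup : Function.update v i y ∈
        Set.univ.pi fun _ : Fin n => Metric.closedBall (0 : X) 1 := by
      intro j _
      rcases eq_or_ne j i with rfl | hj
      · simpa using hy
      · simpa [Function.update_of_ne hj] using hv1 j
    have h3 : |b.det (Function.update v i y)| ≤ |b.det v| := hmax hup
    rw [← h2, abs_mul] at h3
    exact (mul_le_iff_le_one_right hpos).1 h3
  rcases eq_or_ne x 0 with rfl | hx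
  · rw [map_zero]; simp
  have hx' : 0 < ‖x‖ := norm_pos_iff.2 hx
  have h4 := hkey ((‖x‖⁻¹ : ℝ) • x) (by simp [norm_smul, inv_mul_cancel₀ hx'.ne'])
  rw [map_smul, Finsupp.smul_apply, smul_eq_mul, abs_mul, abs_of_pos (inv_pos.2 hx')] at h4
  rwa [inv_mul_le_iff₀ hx', mul_one] at h4

open MeasureTheory in
/-- Volumetric bound on the size of a separated subset of the unit ball. -/
theorem card_le_of_separated_unitBall {X : Type*} [NormedAddCommGroup X] [NormedSpace ℝ X]
    [FiniteDimensional ℝ X] {η : ℝ} (hη : 0 < η) (s : Finset X) (hs : ∀ c ∈ s, ‖c‖ ≤ 1)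
    (h : ∀ c ∈ s, ∀ d ∈ s, c ≠ d → η ≤ ‖c - d‖) :
    (s.card : ℝ) ≤ (1 + 2 / η) ^ Module.finrank ℝ X := by
  borelize X
  let μ : Measure X := Measure.addHaar
  have hδ : 0 < η / 2 := by positivity
  have hρ : 0 < 1 + η / 2 := by positivity
  -- Disjoint balls of radius `η / 2` packed into the ball of radius `1 + η / 2`.
  set A := ⋃ c ∈ s, Metric.ball (c : X) (η / 2) with hA
  have D : Set.Pairwise (s : Set X)
      (Function.onFun Disjoint fun c => Metric.ball (c : X) (η / 2)) := by
    rintro c hc d hd hcd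
    apply Metric.ball_disjoint_ball
    rw [dist_eq_norm, add_halves]
    exact h c hc d hd hcd
  have A_subset : A ⊆ Metric.ball (0 : X) (1 + η / 2) := by
    refine Set.iUnion₂_subset fun x hx => Metric.ball_subset_ball' ?_
    rw [dist_zero_right]
    linarith [hs x hx]
  have I : (s.card : ℝ≥0∞) * ENNReal.ofReal ((η / 2) ^ Module.finrank ℝ X) * μ (Metric.ball 0 1) ≤
      ENNReal.ofReal ((1 + η / 2) ^ Module.finrank ℝ X) * μ (Metric.ball 0 1) :=
    calc
      _ = μ A := by
        rw [hA, measure_biUnion_finset D fun c _ => measurableSet_ball]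
        simp only [μ.addHaar_ball_of_pos _ hδ, Finset.sum_const, nsmul_eq_mul, mul_assoc]
      _ ≤ μ (Metric.ball (0 : X) (1 + η / 2)) := measure_mono A_subset
      _ = _ := by simp only [μ.addHaar_ball_of_pos _ hρ]
  have J := (ENNReal.mul_le_mul_iff_left
    (Metric.measure_ball_pos μ (0 : X) zero_lt_one).ne' measure_ball_lt_top.ne).1 I
  have K := ENNReal.toReal_le_of_le_ofReal (pow_nonneg hρ.le _) J
  rw [ENNReal.toReal_mul, ENNReal.toReal_natCast, ENNReal.toReal_ofReal (by positivity),
    ← le_div_iff₀ (by positivity), ← div_pow] at K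
  have hη2 : (1 + η / 2) / (η / 2) = 1 + 2 / η := by field_simp; ring
  rwa [hη2] at K

/-- The unit sphere has an `η`-net of at most `(1 + 2 / η) ^ n` points. -/
theorem exists_sphere_net {X : Type*} [NormedAddCommGroup X] [NormedSpace ℝ X]
    [FiniteDimensional ℝ X] {η : ℝ} (hη : 0 < η) :
    ∃ s : Finset X, (∀ c ∈ s, ‖c‖ = 1) ∧ (s.card : ℝ) ≤ (1 + 2 / η) ^ Module.finrank ℝ X ∧
      ∀ x : X, ‖x‖ = 1 → ∃ c ∈ s, ‖x - c‖ ≤ η := by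
  classical
  let P : ℕ → Prop := fun k => ∃ s : Finset X, s.card = k ∧ (∀ c ∈ s, ‖c‖ = 1) ∧
    ∀ c ∈ s, ∀ d ∈ s, c ≠ d → η ≤ ‖c - d‖
  have hbd : ∀ s : Finset X, (∀ c ∈ s, ‖c‖ = 1) → (∀ c ∈ s, ∀ d ∈ s, c ≠ d → η ≤ ‖c - d‖) →
      (s.card : ℝ) ≤ (1 + 2 / η) ^ Module.finrank ℝ X := fun s h1 h2 =>
    card_le_of_separated_unitBall hη s (fun c hc => (h1 c hc).le) h2
  -- The volumetric bound lets a separated set of maximal cardinality be picked; maximality makes it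
  -- a net.
  let M := ⌊(1 + 2 / η) ^ Module.finrank ℝ X⌋₊
  have hP0 : P 0 := ⟨∅, by simp⟩
  obtain ⟨s, hcard, hs1, hs2⟩ : P (Nat.findGreatest P M) := Nat.findGreatest_spec (Nat.zero_le M) hP0
  refine ⟨s, hs1, hbd s hs1 hs2, fun x hx => ?_⟩
  by_contra! hfar
  have hxs : x ∉ s := fun hmem => by
    have := hfar x hmem
    simp at this
    linarith
  have h1 : ∀ c ∈ insert x s, ‖c‖ = 1 := by
    intro c hc
    rcases Finset.mem_insert.1 hc with rfl | hc
    exacts [hx, hs1 c hc]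
  have h2 : ∀ c ∈ insert x s, ∀ d ∈ insert x s, c ≠ d → η ≤ ‖c - d‖ := by
    intro c hc d hd hcd
    rcases Finset.mem_insert.1 hc with hc' | hc <;> rcases Finset.mem_insert.1 hd with hd' | hd
    · exact absurd (hc'.trans hd'.symm) hcd
    · rw [hc']; exact (hfar d hd).le
    · rw [hd', norm_sub_rev]; exact (hfar c hc).le
    · exact hs2 c hc d hd hcd
  have hle : (insert x s).card ≤ M := Nat.le_floor (hbd _ h1 h2)
  have := Nat.le_findGreatest (P := P) hle ⟨_, rfl, h1, h2⟩
  rw [Finset.card_insert_of_notMem hxs] at this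
  omega

/-! ### Averages over lattice boxes. -/

/-- The index box `{0, …, k - 1}ⁿ`. -/
def indexBox (n k : ℕ) : Finset (Fin n → ℕ) := Fintype.piFinset fun _ => Finset.range k

/-- The point `∑ wᵢ eᵢ` of the lattice generated by `e`. -/
def latticePoint {X : Type*} [AddCommMonoid X] {n : ℕ} (e : Fin n → X) (w : Fin n → ℕ) : X :=
  ∑ i, w i • e i

/-- The average of `g` over the translate by `x` of the box `{∑ wᵢ eᵢ : 0 ≤ wᵢ < k}`. -/
noncomputable def boxAverage {X E : Type*} [AddCommMonoid X] [AddCommGroup E] [Module ℝ E] {n : ℕ}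
    (e : Fin n → X) (k : ℕ) (g : X → E) (x : X) : E :=
  ((k : ℝ) ^ n)⁻¹ • ∑ w ∈ indexBox n k, g (x + latticePoint e w)

theorem card_indexBox (n k : ℕ) : (indexBox n k).card = k ^ n := by
  simp [indexBox]

theorem mem_indexBox {n k : ℕ} {w : Fin n → ℕ} : w ∈ indexBox n k ↔ ∀ i, w i < k := by
  simp [indexBox]

section Box

variable {X : Type*} [NormedAddCommGroup X] {n : ℕ} {e : Fin n → X}
variable {E : Type*} [NormedAddCommGroup E] [NormedSpace ℝ E]

theorem norm_latticePoint_le (he : ∀ i, ‖e i‖ ≤ 1) {k : ℕ} {w : Fin n → ℕ}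
    (hw : w ∈ indexBox n k) : ‖latticePoint e w‖ ≤ n * k := by
  refine (norm_sum_le_of_le (f := fun i => w i • e i) (n := fun _ => (k : ℝ)) Finset.univ
    fun i _ => ?_).trans ?_
  · refine (norm_nsmul_le (n := w i) (a := e i)).trans ?_
    have h1 : (w i : ℝ) ≤ k := by exact_mod_cast (mem_indexBox.1 hw i).le
    nlinarith [he i, norm_nonneg (e i), (Nat.cast_nonneg (w i) : (0 : ℝ) ≤ w i)]
  · simp

theorem boxAverage_sub (k : ℕ) (g g' : X → E) (x : X) :
    boxAverage e k (fun y => g y - g' y) x = boxAverage e k g x - boxAverage e k g' x := by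
  simp [boxAverage, Finset.sum_sub_distrib, smul_sub]

theorem boxAverage_smul (k : ℕ) (c : ℝ) (g : X → E) (x : X) :
    boxAverage e k (fun y => c • g y) x = c • boxAverage e k g x := by
  simp [boxAverage, ← Finset.smul_sum, smul_comm c]

theorem boxAverage_sum {ι : Type*} (s : Finset ι) (k : ℕ) (g : ι → X → E) (x : X) :
    boxAverage e k (fun y => ∑ i ∈ s, g i y) x = ∑ i ∈ s, boxAverage e k (g i) x := by
  simp only [boxAverage]
  rw [Finset.sum_comm, Finset.smul_sum]

theorem boxAverage_translate (k : ℕ) (g : X → E) (v x : X) :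
    boxAverage e k (fun y => g (y + v)) x = boxAverage e k g (x + v) := by
  simp only [boxAverage]
  congr 1
  exact Finset.sum_congr rfl fun w _ => by rw [add_right_comm]

theorem boxAverage_const {k : ℕ} (hk : 0 < k) (c : E) (x : X) :
    boxAverage e k (fun _ => c) x = c := by
  have h : ((k : ℝ) ^ n) ≠ 0 := by positivity
  simp [boxAverage, card_indexBox, ← Nat.cast_smul_eq_nsmul ℝ, smul_smul, h]

theorem norm_boxAverage_le_boxAverage_norm (k : ℕ) (g : X → E) (x : X) :
    ‖boxAverage e k g x‖ ≤ boxAverage e k (fun y => ‖g y‖) x := by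
  simp only [boxAverage, norm_smul, smul_eq_mul, norm_inv, norm_pow, Real.norm_natCast]
  gcongr
  exact norm_sum_le _ _

theorem boxAverage_le_boxAverage {k : ℕ} {g g' : X → ℝ} {x : X}
    (h : ∀ w ∈ indexBox n k, g (x + latticePoint e w) ≤ g' (x + latticePoint e w)) :
    boxAverage e k g x ≤ boxAverage e k g' x := by
  simp only [boxAverage, smul_eq_mul]
  gcongr with w hw
  exact h w hw

theorem boxAverage_le {k : ℕ} (hk : 0 < k) {g : X → ℝ} {x : X} {c : ℝ}
    (h : ∀ w ∈ indexBox n k, g (x + latticePoint e w) ≤ c) : boxAverage e k g x ≤ c := by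
  simpa [boxAverage_const hk] using boxAverage_le_boxAverage (e := e) (g' := fun _ => c) h

theorem le_boxAverage {k : ℕ} (hk : 0 < k) {g : X → ℝ} {x : X} {c : ℝ}
    (h : ∀ w ∈ indexBox n k, c ≤ g (x + latticePoint e w)) : c ≤ boxAverage e k g x := by
  simpa [boxAverage_const hk] using boxAverage_le_boxAverage (e := e) (g := fun _ => c) h

theorem norm_boxAverage_le {k : ℕ} (hk : 0 < k) {g : X → E} {x : X} {c : ℝ}
    (h : ∀ w ∈ indexBox n k, ‖g (x + latticePoint e w)‖ ≤ c) : ‖boxAverage e k g x‖ ≤ c :=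
  (norm_boxAverage_le_boxAverage_norm k g x).trans (boxAverage_le hk h)

theorem latticePoint_add_single (w : Fin n → ℕ) (i : Fin n) :
    latticePoint e (w + Pi.single i 1) = latticePoint e w + e i := by
  simp only [latticePoint, Pi.add_apply, add_smul, Finset.sum_add_distrib]
  congr 1
  rw [Finset.sum_eq_single i] <;> simp +contextual

/-- The average of a bounded function over a box of side `k` varies by `O(1 / k)` in each
direction of the lattice. -/
theorem norm_boxAverage_step_le {k : ℕ} (hk : 0 < k) {g : X → E} {B : ℝ} (hB : ∀ x, ‖g x‖ ≤ B)
    (x : X) (i : Fin n) : ‖boxAverage e k g (x + e i) - boxAverage e k g x‖ ≤ 2 * B / k := by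
  classical
  let G : (Fin n → ℕ) → E := fun w => g (x + latticePoint e w)
  have hface : ∀ c < k, ((indexBox n k).filter fun w => w i = c).card = k ^ (n - 1) := by
    intro c hc
    have := Fintype.card_filter_piFinset_const_eq_of_mem (ι := Fin n) (Finset.range k) i
      (Finset.mem_range.2 hc)
    simpa [indexBox] using this
  have hstep : boxAverage e k g (x + e i) = ((k : ℝ) ^ n)⁻¹ •
      ∑ w ∈ indexBox n k, G (w + Pi.single i 1) := by
    simp only [boxAverage, G, latticePoint_add_single]
    congr 1
    exact Finset.sum_congr rfl fun w _ => by rw [add_assoc, add_comm (e i)]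
  have hsplit1 := Finset.sum_filter_add_sum_filter_not (indexBox n k) (fun w => w i = k - 1)
    fun w => G (w + Pi.single i 1)
  have hsplit2 := Finset.sum_filter_add_sum_filter_not (indexBox n k) (fun w => w i = 0) G
  -- Translation by `e i` matches the box minus its far face with the box minus its near face; only
  -- two faces of `k ^ (n - 1)` points survive in the difference.
  have hbij : ∑ w ∈ (indexBox n k).filter (fun w => ¬ w i = k - 1), G (w + Pi.single i 1) =
      ∑ w ∈ (indexBox n k).filter (fun w => ¬ w i = 0), G w := by
    refine Finset.sum_nbij' (fun w => w + Pi.single i 1) (fun w => w - Pi.single i 1) ?_ ?_ ?_ ?_ ?_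
    · intro w hw
      simp only [Finset.mem_filter, mem_indexBox] at hw ⊢
      refine ⟨fun j => ?_, by simp⟩
      rcases eq_or_ne j i with rfl | hj
      · have := hw.1 j
        simp; omega
      · simpa [Pi.single_eq_of_ne hj] using hw.1 j
    · intro w hw
      simp only [Finset.mem_filter, mem_indexBox] at hw ⊢
      refine ⟨fun j => lt_of_le_of_lt (by simp) (hw.1 j), ?_⟩
      have := hw.1 i
      simp; omega
    · intro w _
      exact add_tsub_cancel_right w _
    · intro w hw
      simp only [Finset.mem_filter, mem_indexBox] at hw
      refine tsub_add_cancel_of_le fun j => ?_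
      rcases eq_or_ne j i with rfl | hj
      · simp; omega
      · simp [Pi.single_eq_of_ne hj]
    · intro w _
      rfl
  have hbound : ∀ (c : ℕ), c < k → ∀ H : (Fin n → ℕ) → E, (∀ w, ‖H w‖ ≤ B) →
      ‖∑ w ∈ (indexBox n k).filter (fun w => w i = c), H w‖ ≤ (k : ℝ) ^ (n - 1) * B := by
    intro c hc H hH
    refine (norm_sum_le_of_le _ fun w _ => hH w).trans ?_
    rw [Finset.sum_const, hface c hc, nsmul_eq_mul]
    simp
  have hn : n - 1 + 1 = n := Nat.succ_pred_eq_of_pos i.pos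
  have hk' : (0 : ℝ) < k := by exact_mod_cast hk
  have hdiff : boxAverage e k g (x + e i) - boxAverage e k g x = ((k : ℝ) ^ n)⁻¹ •
      (∑ w ∈ (indexBox n k).filter (fun w => w i = k - 1), G (w + Pi.single i 1) -
        ∑ w ∈ (indexBox n k).filter (fun w => w i = 0), G w) := by
    rw [hstep, ← hsplit1, hbij]
    have : boxAverage e k g x = ((k : ℝ) ^ n)⁻¹ • ∑ w ∈ indexBox n k, G w := rfl
    rw [this, ← hsplit2, ← smul_sub]
    congr 1
    abel
  rw [hdiff, norm_smul, norm_inv, norm_pow, Real.norm_natCast]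
  have h1 := hbound (k - 1) (by omega) (fun w => G (w + Pi.single i 1)) fun w => hB _
  have h2 := hbound 0 hk G fun w => hB _
  have h3 := (norm_sub_le _ _).trans (add_le_add h1 h2)
  calc _ ≤ ((k : ℝ) ^ n)⁻¹ * ((k : ℝ) ^ (n - 1) * B + (k : ℝ) ^ (n - 1) * B) := by gcongr
    _ = 2 * B / k := by
      nth_rewrite 1 [← hn]
      rw [pow_succ]
      field_simp
      ring

end Box

/-! ### Discrete derivatives. -/

section Steps

variable {X : Type*} [NormedAddCommGroup X] [NormedSpace ℝ X] {n : ℕ}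
variable {Y : Type*} [NormedAddCommGroup Y] [NormedSpace ℝ Y]

/-- The discrete derivative of `G` at `x`: the linear map taking each basis vector `e i` to
`G (x + e i) - G x`. -/
noncomputable def stepMap (e : Module.Basis (Fin n) ℝ X) (G : X → Y) (x : X) : X →ₗ[ℝ] Y :=
  e.constr ℝ fun i => G (x + e i) - G x

variable {e : Module.Basis (Fin n) ℝ X}

@[simp] theorem stepMap_basis (G : X → Y) (x : X) (i : Fin n) :
    stepMap e G x (e i) = G (x + e i) - G x := by
  simp [stepMap]

theorem stepMap_boxAverage (k : ℕ) (G : X → Y) (x a : X) :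
    stepMap e (boxAverage e k G) x a = boxAverage e k (fun y => stepMap e G y a) x := by
  simp only [stepMap, Module.Basis.constr_apply_fintype]
  rw [boxAverage_sum]
  refine Finset.sum_congr rfl fun i _ => ?_
  rw [boxAverage_smul, boxAverage_sub, boxAverage_translate]

/-- A multiset of indices encodes a lattice path with positive steps, and its cardinality is the
length of the path; a general lattice vector is a difference of two such sums. -/
theorem norm_sub_le_of_step_le {X Y : Type*} [NormedAddCommGroup X] [NormedAddCommGroup Y]
    {e : Fin n → X} {g : X → Y} {κ : ℝ}
    (h : ∀ x i, ‖g (x + e i) - g x‖ ≤ κ) (x : X) (P : Multiset (Fin n)) :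
    ‖g (x + (P.map e).sum) - g x‖ ≤ P.card * κ := by
  induction P using Multiset.induction_on with
  | empty => simp
  | cons i P ih =>
    have h1 := h (x + (P.map e).sum) i
    have h2 := norm_add_le (g (x + (P.map e).sum + e i) - g (x + (P.map e).sum))
      (g (x + (P.map e).sum) - g x)
    rw [sub_add_sub_cancel] at h2
    rw [Multiset.map_cons, Multiset.sum_cons, Multiset.card_cons, add_comm (e i), ← add_assoc]
    push_cast
    linarith

theorem norm_stepMap_sum_le {G : X → Y} {β : ℝ} (hβ : ∀ x i, ‖G (x + e i) - G x‖ ≤ β)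
    (x : X) (P : Multiset (Fin n)) : ‖stepMap e G x (P.map e).sum‖ ≤ P.card * β := by
  induction P using Multiset.induction_on with
  | empty => simp
  | cons i P ih =>
    have h2 := norm_add_le (stepMap e G x (e i)) (stepMap e G x (P.map e).sum)
    rw [stepMap_basis] at h2
    rw [Multiset.map_cons, Multiset.sum_cons, Multiset.card_cons, map_add, stepMap_basis]
    push_cast
    linarith [hβ x i]

/-- If the discrete derivative of `G` varies slowly, then `G` is nearly affine. -/
theorem norm_sub_sub_stepMap_le {G : X → Y} {κ : ℝ} (hκ : 0 ≤ κ)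
    (h : ∀ x i l, ‖(G (x + e l + e i) - G (x + e l)) - (G (x + e i) - G x)‖ ≤ κ)
    (x : X) (P : Multiset (Fin n)) :
    ‖G (x + (P.map e).sum) - G x - stepMap e G x (P.map e).sum‖ ≤ κ * (P.card : ℝ) ^ 2 := by
  induction P using Multiset.induction_on with
  | empty => simp
  | cons i P ih =>
    -- The increment in direction `i` drifts by at most `P.card * κ` along the path; adding these
    -- drifts gives the quadratic bound.
    have h1 := norm_sub_le_of_step_le (e := e) (g := fun y => G (y + e i) - G y)
      (fun y l => h y i l) x P
    have h2 := norm_add_le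
      (G (x + (P.map e).sum + e i) - G (x + (P.map e).sum) - (G (x + e i) - G x))
      (G (x + (P.map e).sum) - G x - stepMap e G x (P.map e).sum)
    have h3 : G (x + (P.map e).sum + e i) - G (x + (P.map e).sum) - (G (x + e i) - G x) +
        (G (x + (P.map e).sum) - G x - stepMap e G x (P.map e).sum) =
        G (x + (P.map e).sum + e i) - G x -
          (G (x + e i) - G x + stepMap e G x (P.map e).sum) := by abel
    rw [h3] at h2
    rw [Multiset.map_cons, Multiset.sum_cons, Multiset.card_cons, map_add, stepMap_basis,
      add_comm (e i) (P.map e).sum, ← add_assoc]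
    push_cast
    nlinarith [(Nat.cast_nonneg P.card : (0 : ℝ) ≤ P.card)]

end Steps

/-! ### Iterated averages and the pigeonhole over scales. -/

section Iterates

variable {X : Type*} [NormedAddCommGroup X] [NormedSpace ℝ X] {n : ℕ}
variable {Y : Type*} [NormedAddCommGroup Y] [NormedSpace ℝ Y]
variable {e : Module.Basis (Fin n) ℝ X}

/-- For `a = ∑ P - ∑ M` in the lattice, the discrete derivative of a nearly affine `G` in the
direction `a` is close to an increment of `G`. -/
theorem norm_sub_sub_stepMap_sub_le {G : X → Y} {κ : ℝ} (hκ : 0 ≤ κ)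
    (h : ∀ x i l, ‖(G (x + e l + e i) - G (x + e l)) - (G (x + e i) - G x)‖ ≤ κ)
    (x : X) {P M : Multiset (Fin n)} {H : ℕ} (hPM : P.card + M.card ≤ H) :
    ‖G (x + (P.map e).sum) - G (x + (M.map e).sum) -
      stepMap e G x ((P.map e).sum - (M.map e).sum)‖ ≤ κ * (H : ℝ) ^ 2 := by
  have h1 := norm_sub_sub_stepMap_le hκ h x P
  have h2 := norm_sub_sub_stepMap_le hκ h x M
  have h3 := (norm_sub_le _ _).trans (add_le_add h1 h2)
  have h4 : (P.card : ℝ) + M.card ≤ H := by exact_mod_cast hPM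
  have hP : (0 : ℝ) ≤ P.card := Nat.cast_nonneg _
  have hM : (0 : ℝ) ≤ M.card := Nat.cast_nonneg _
  have h5 : (P.card : ℝ) ^ 2 + (M.card : ℝ) ^ 2 ≤ (H : ℝ) ^ 2 := by nlinarith
  rw [map_sub]
  calc _ = _ := by congr 1; abel
    _ ≤ _ := h3
    _ ≤ _ := by rw [← mul_add]; gcongr

theorem norm_stepMap_sub_le {G : X → Y} {β : ℝ} (h0 : 0 ≤ β)
    (hβ : ∀ x i, ‖G (x + e i) - G x‖ ≤ β) (x : X) {P M : Multiset (Fin n)} {H : ℕ}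
    (hPM : P.card + M.card ≤ H) :
    ‖stepMap e G x ((P.map e).sum - (M.map e).sum)‖ ≤ β * H := by
  have h1 := norm_stepMap_sum_le hβ x P
  have h2 := norm_stepMap_sum_le hβ x M
  have h3 := (norm_sub_le _ _).trans (add_le_add h1 h2)
  have h4 : (P.card : ℝ) + M.card ≤ H := by exact_mod_cast hPM
  rw [map_sub]
  nlinarith

/-- If `G` expands the distances along segments in the direction `a`, then the average of the norm
of its discrete derivative in the direction `a` over a large box is at least about `‖a‖`. -/
theorem le_boxAverage_norm_stepMap {G : X → Y} {β κ c : ℝ} (h0 : 0 ≤ β) (hκ : 0 ≤ κ)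
    (hβ : ∀ x i, ‖G (x + e i) - G x‖ ≤ β)
    (h : ∀ x i l, ‖(G (x + e l + e i) - G (x + e l)) - (G (x + e i) - G x)‖ ≤ κ)
    {P M : Multiset (Fin n)} {H : ℕ} (hPM : P.card + M.card ≤ H) {a : X}
    (ha : a = (P.map e).sum - (M.map e).sum) {k L : ℕ} (hk : 0 < k) (hL : 0 < L) {x : X}
    (hlow : ∀ w ∈ indexBox n k, L * ‖a‖ - c ≤
      ‖G (x + latticePoint e w + (M.map e).sum + L • a) -
        G (x + latticePoint e w + (M.map e).sum)‖) :
    ‖a‖ - c / L - κ * (H : ℝ) ^ 2 - 2 * β * (H : ℝ) ^ 2 * L / k ≤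
      boxAverage e k (fun y => ‖stepMap e G y a‖) x := by
  set φ : X → ℝ := fun y => ‖stepMap e G y a‖ with hφ
  have hφB : ∀ y, ‖φ y‖ ≤ β * H := fun y => by
    rw [hφ, norm_norm, ha]; exact norm_stepMap_sub_le h0 hβ y hPM
  have hLpos : (0 : ℝ) < L := by exact_mod_cast hL
  have hkpos : (0 : ℝ) < k := by exact_mod_cast hk
  have hcard : (P.card : ℝ) + M.card ≤ H := by exact_mod_cast hPM
  have hH : (0 : ℝ) ≤ H := Nat.cast_nonneg _
  -- Translating a large box by `t • a` with `t < L` hardly changes the average. Both `x + t • a`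
  -- and `x` are reached by positive paths from `x - t • (M.map e).sum`.
  have hshift : ∀ t ∈ Finset.range L, boxAverage e k φ (x + t • a) ≤
      boxAverage e k φ x + 2 * β * (H : ℝ) ^ 2 * L / k := by
    intro t ht
    have hstep := norm_boxAverage_step_le (e := e) hk hφB
    have h1 := norm_sub_le_of_step_le hstep (x - t • (M.map e).sum) (t • P)
    have h2 := norm_sub_le_of_step_le hstep (x - t • (M.map e).sum) (t • M)
    have e1 : x - t • (M.map e).sum + ((t • P).map e).sum = x + t • a := by
      rw [Multiset.map_nsmul, Multiset.sum_nsmul, ha, smul_sub]; abel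
    have e2 : x - t • (M.map e).sum + ((t • M).map e).sum = x := by
      rw [Multiset.map_nsmul, Multiset.sum_nsmul]; abel
    rw [e1] at h1
    rw [e2] at h2
    rw [Multiset.card_nsmul, Nat.cast_mul] at h1 h2
    rw [Real.norm_eq_abs] at h1 h2
    have h3 := (abs_le.1 h1).2
    have h4 := (abs_le.1 h2).1
    have ht' : (t : ℝ) ≤ L := by exact_mod_cast (Finset.mem_range.1 ht).le
    have h5 : (t : ℝ) * (P.card + M.card) ≤ L * H := by gcongr
    have h6 : (t : ℝ) * (P.card + M.card) * (2 * (β * H) / k) ≤ L * H * (2 * (β * H) / k) := by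
      gcongr
    have h7 : L * H * (2 * (β * H) / k) = 2 * β * (H : ℝ) ^ 2 * L / k := by ring
    linarith
  have hsum : ∑ t ∈ Finset.range L, boxAverage e k φ (x + t • a) ≤
      L * (boxAverage e k φ x + 2 * β * (H : ℝ) ^ 2 * L / k) := by
    refine (Finset.sum_le_sum hshift).trans_eq ?_
    rw [Finset.sum_const, Finset.card_range, nsmul_eq_mul]
  have heq : ∑ t ∈ Finset.range L, boxAverage e k φ (x + t • a) =
      boxAverage e k (fun y => ∑ t ∈ Finset.range L, φ (y + t • a)) x := by
    rw [boxAverage_sum]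
    exact Finset.sum_congr rfl fun t _ => (boxAverage_translate k φ _ x).symm
  -- By near-affinity, the derivatives at `y + t • a` are close to consecutive increments of `G` on
  -- the segment from `y + (M.map e).sum`; these telescope to the increment bounded by `hlow`.
  have hmain : L * ‖a‖ - c - L * (κ * (H : ℝ) ^ 2) ≤
      boxAverage e k (fun y => ∑ t ∈ Finset.range L, φ (y + t • a)) x := by
    refine le_boxAverage hk fun w hw => ?_
    set y := x + latticePoint e w with hy
    have h1 : ∀ t ∈ Finset.range L, ‖G (y + (M.map e).sum + (t + 1) • a) -
        G (y + (M.map e).sum + t • a) - stepMap e G (y + t • a) a‖ ≤ κ * (H : ℝ) ^ 2 := by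
      intro t _
      have h2 := norm_sub_sub_stepMap_sub_le hκ h (y + t • a) hPM
      rw [← ha] at h2
      have e1 : y + t • a + (P.map e).sum = y + (M.map e).sum + (t + 1) • a := by
        rw [add_smul, one_smul, ha]; abel
      have e2 : y + t • a + (M.map e).sum = y + (M.map e).sum + t • a := by abel
      rwa [e1, e2] at h2
    have h2 := norm_sum_le_of_le _ h1
    rw [Finset.sum_sub_distrib,
      Finset.sum_range_sub (fun t => G (y + (M.map e).sum + t • a)), zero_smul, add_zero] at h2
    have h3 : ‖∑ t ∈ Finset.range L, stepMap e G (y + t • a) a‖ ≤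
        ∑ t ∈ Finset.range L, φ (y + t • a) := norm_sum_le _ _
    have h4 := norm_sub_norm_le (G (y + (M.map e).sum + L • a) - G (y + (M.map e).sum))
      (∑ t ∈ Finset.range L, stepMap e G (y + t • a) a)
    have h5 := hlow w hw
    simp only [Finset.sum_const, Finset.card_range, nsmul_eq_mul] at h2
    linarith
  rw [heq] at hsum
  have h8 : L * (‖a‖ - c / L - κ * (H : ℝ) ^ 2 - 2 * β * (H : ℝ) ^ 2 * L / k) ≤
      L * boxAverage e k φ x := by
    have h9 : (L : ℝ) * (c / L) = c := by field_simp
    calc _ = L * ‖a‖ - L * (c / L) - L * (κ * (H : ℝ) ^ 2) -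
          L * (2 * β * (H : ℝ) ^ 2 * L / k) := by ring
      _ ≤ _ := by rw [h9]; linarith
  exact le_of_mul_le_mul_left h8 hLpos

/-- The successive averages of `F` over boxes of sides `K, K ^ 2, …, K ^ j`. -/
noncomputable def iteratedAverage (e : Module.Basis (Fin n) ℝ X) (K : ℕ) (F : X → Y) : ℕ → X → Y
  | 0 => F
  | j + 1 => boxAverage e (K ^ (j + 1)) (iteratedAverage e K F j)

variable {K : ℕ} {F : X → Y} {β : ℝ}

theorem norm_iteratedAverage_step_le (hK : 2 ≤ K) (hβ : ∀ x i, ‖F (x + e i) - F x‖ ≤ β) (j : ℕ) :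
    ∀ x i, ‖iteratedAverage e K F j (x + e i) - iteratedAverage e K F j x‖ ≤ β := by
  induction j with
  | zero => exact hβ
  | succ j ih =>
    intro x i
    rw [iteratedAverage, ← boxAverage_translate, ← boxAverage_sub]
    exact norm_boxAverage_le (by positivity) fun w _ => ih _ i

/-- A first difference of the `(j + 1)`-st iterate is a box average of a function bounded by `β`, so
it varies by `O(β / K ^ (j + 1))` per step. -/
theorem norm_iteratedAverage_second_step_le (hK : 2 ≤ K)
    (hβ : ∀ x i, ‖F (x + e i) - F x‖ ≤ β) (j : ℕ) (x : X) (i l : Fin n) :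
    ‖(iteratedAverage e K F (j + 1) (x + e l + e i) - iteratedAverage e K F (j + 1) (x + e l)) -
      (iteratedAverage e K F (j + 1) (x + e i) - iteratedAverage e K F (j + 1) x)‖ ≤
      2 * β / (K : ℝ) ^ (j + 1) := by
  have h := norm_boxAverage_step_le (e := e) (k := K ^ (j + 1)) (by positivity)
    (g := fun y => iteratedAverage e K F j (y + e i) - iteratedAverage e K F j y)
    (fun y => norm_iteratedAverage_step_le hK hβ j y i) x l
  rw [boxAverage_sub, boxAverage_sub, boxAverage_translate, boxAverage_translate] at h
  exact_mod_cast h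

theorem norm_boxAverage_sub_le {k : ℕ} (hk : 0 < k) (h0 : 0 ≤ β)
    (hβ : ∀ x i, ‖F (x + e i) - F x‖ ≤ β) (x : X) :
    ‖boxAverage e k F x - F x‖ ≤ β * n * k := by
  have h : boxAverage e k F x - F x = boxAverage e k (fun y => F y - F x) x := by
    rw [boxAverage_sub, boxAverage_const hk]
  rw [h]
  refine norm_boxAverage_le hk fun w hw => ?_
  have h1 := norm_sub_le_of_step_le hβ x (∑ i, w i • ({i} : Multiset (Fin n)))
  have h2 : ((∑ i, w i • ({i} : Multiset (Fin n))).map e).sum = latticePoint e w := by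
    have := map_sum (Multiset.mapAddMonoidHom (e : Fin n → X)) (fun i => w i • ({i} : Multiset (Fin n)))
      Finset.univ
    simp only [Multiset.coe_mapAddMonoidHom] at this
    rw [this, Multiset.sum_sum]
    simp [latticePoint, Multiset.map_nsmul, Multiset.sum_nsmul]
  have h3 : ((∑ i, w i • ({i} : Multiset (Fin n))).card : ℝ) ≤ n * k := by
    rw [Multiset.card_sum]
    simp only [Multiset.card_nsmul, Multiset.card_singleton, mul_one]
    push_cast
    refine (Finset.sum_le_card_nsmul _ _ (k : ℝ) fun i _ => ?_).trans (by simp)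
    exact_mod_cast (mem_indexBox.1 hw i).le
  rw [h2] at h1
  refine h1.trans ?_
  nlinarith

/-- The inductive step for `K + ⋯ + K ^ j ≤ 2 K ^ j`, which controls the total displacement under
the first `j` averagings. -/
theorem two_mul_pow_add_pow_le (hK : 2 ≤ K) (j : ℕ) :
    2 * (K : ℝ) ^ j + (K : ℝ) ^ (j + 1) ≤ 2 * (K : ℝ) ^ (j + 1) := by
  have hK' : (2 : ℝ) ≤ K := by exact_mod_cast hK
  have : (0 : ℝ) < (K : ℝ) ^ j := by positivity
  rw [pow_succ]
  nlinarith

theorem norm_iteratedAverage_sub_le (hK : 2 ≤ K) (h0 : 0 ≤ β)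
    (hβ : ∀ x i, ‖F (x + e i) - F x‖ ≤ β) (j : ℕ) (x : X) :
    ‖iteratedAverage e K F j x - F x‖ ≤ β * n * (2 * (K : ℝ) ^ j) := by
  induction j with
  | zero =>
    simp only [iteratedAverage, sub_self, norm_zero]
    positivity
  | succ j ih =>
    have h1 := norm_boxAverage_sub_le (k := K ^ (j + 1)) (by positivity) h0
      (norm_iteratedAverage_step_le hK hβ j) x
    have h2 := norm_add_le (iteratedAverage e K F (j + 1) x - iteratedAverage e K F j x)
      (iteratedAverage e K F j x - F x)
    rw [sub_add_sub_cancel] at h2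
    rw [← iteratedAverage] at h1
    have h3 := mul_le_mul_of_nonneg_left (two_mul_pow_add_pow_le hK j)
      (by positivity : 0 ≤ β * n)
    push_cast at h1
    linarith

/-- Averaging preserves upper bounds on the increments, on a smaller ball. -/
theorem norm_iteratedAverage_sub_iteratedAverage_le (hK : 2 ≤ K) (he : ∀ i, ‖e i‖ ≤ 1) {R D : ℝ}
    (hF : ∀ x y : X, ‖x‖ ≤ R → ‖y‖ ≤ R → ‖F x - F y‖ ≤ D * (‖x - y‖ + 1)) (j : ℕ) :
    ∀ x y : X, ‖x‖ ≤ R - n * (2 * (K : ℝ) ^ j) → ‖y‖ ≤ R - n * (2 * (K : ℝ) ^ j) →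
      ‖iteratedAverage e K F j x - iteratedAverage e K F j y‖ ≤ D * (‖x - y‖ + 1) := by
  induction j with
  | zero =>
    intro x y hx hy
    have : (0 : ℝ) ≤ n * (2 * (K : ℝ) ^ 0) := by positivity
    exact hF x y (by linarith) (by linarith)
  | succ j ih =>
    intro x y hx hy
    have h3 := mul_le_mul_of_nonneg_left (two_mul_pow_add_pow_le hK j)
      (by positivity : (0 : ℝ) ≤ n)
    have hxy : iteratedAverage e K F (j + 1) y =
        boxAverage e (K ^ (j + 1)) (iteratedAverage e K F j) (x + (y - x)) := by
      rw [add_sub_cancel, iteratedAverage]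
    rw [hxy, iteratedAverage, ← boxAverage_translate, ← boxAverage_sub]
    refine norm_boxAverage_le (by positivity) fun w hw => ?_
    have hw' := norm_latticePoint_le he hw
    push_cast at hw'
    have h1 := norm_add_le x (latticePoint e w)
    have h2 := norm_add_le y (latticePoint e w)
    have e1 : x + latticePoint e w + (y - x) = y + latticePoint e w := by abel
    rw [e1]
    have h4 := ih (x + latticePoint e w) (y + latticePoint e w) (by linarith) (by linarith)
    rwa [add_sub_add_right_eq_sub] at h4

/-- Pigeonhole over the scales: at some scale and some place, averaging hardly decreases the norms
of the discrete derivatives. -/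
theorem exists_scale_stable (hK : 2 ≤ K) (he : ∀ i, ‖e i‖ ≤ 1) (A : Finset X) {B : ℝ} {m : ℕ}
    (hB : ∀ x, ∑ a ∈ A, ‖stepMap e (iteratedAverage e K F 1) x a‖ ≤ B) (hm : B < m) :
    ∃ j < m, ∃ x : X, ‖x‖ ≤ n * (2 * (K : ℝ) ^ (m + 1)) ∧
      ∑ a ∈ A, (boxAverage e (K ^ (j + 2))
        (fun y => ‖stepMap e (iteratedAverage e K F (j + 1)) y a‖) x -
          ‖stepMap e (iteratedAverage e K F (j + 2)) x a‖) ≤ 1 := by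
  by_contra! hcon
  -- If every scale lost more than `1`, the sum would have fallen below `B - m < 0` at the origin.
  -- The admissible balls shrink so that each averaging box stays inside the previous ball.
  have hclaim : ∀ j ≤ m, ∀ x : X,
      ‖x‖ ≤ n * (2 * (K : ℝ) ^ (m + 1)) - n * (2 * (K : ℝ) ^ (j + 1)) →
      ∑ a ∈ A, ‖stepMap e (iteratedAverage e K F (j + 1)) x a‖ ≤ B - j := by
    intro j
    induction j with
    | zero => intro _ x _; simpa using hB x
    | succ j ih =>
      intro hj x hx
      have hpos : (0 : ℝ) ≤ n * (2 * (K : ℝ) ^ (j + 1 + 1)) := by positivity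
      have h1 := hcon j (by omega) x (by linarith)
      rw [Finset.sum_sub_distrib, ← boxAverage_sum] at h1
      have h3 := mul_le_mul_of_nonneg_left (two_mul_pow_add_pow_le hK (j + 1))
        (by positivity : (0 : ℝ) ≤ n)
      have h2 : boxAverage e (K ^ (j + 2))
          (fun y => ∑ a ∈ A, ‖stepMap e (iteratedAverage e K F (j + 1)) y a‖) x ≤ B - j := by
        refine boxAverage_le (by positivity) fun w hw => ih (by omega) _ ?_
        have hw' := norm_latticePoint_le he hw
        push_cast at hw'
        have := norm_add_le x (latticePoint e w)
        linarith
      push_cast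
      linarith
  have h := hclaim m le_rfl 0 (by simp)
  have h2 : (0 : ℝ) ≤ ∑ a ∈ A, ‖stepMap e (iteratedAverage e K F (m + 1)) 0 a‖ :=
    Finset.sum_nonneg fun _ _ => norm_nonneg _
  linarith

end Iterates

/-! ### From a coarse embedding to a linear map. -/

section Coarse

variable {X : Type*} [NormedAddCommGroup X] [NormedSpace ℝ X] {n : ℕ}
variable {Y : Type*} [NormedAddCommGroup Y] [NormedSpace ℝ Y]
variable {e : Module.Basis (Fin n) ℝ X}

theorem norm_map_sum_le {X : Type*} [NormedAddCommGroup X] {e : Fin n → X} (he : ∀ i, ‖e i‖ ≤ 1) (P : Multiset (Fin n)) :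
    ‖(P.map e).sum‖ ≤ P.card := by
  simpa using norm_sub_le_of_step_le (e := e) (g := fun x : X => x) (κ := 1)
    (fun x i => by simpa using he i) 0 P

/-- A coarsely bi-Lipschitz map on a large ball has, at some place and some scale, a discrete
derivative which is nearly as expanding, in finitely many prescribed directions. -/
theorem exists_linearMap_of_coarse (hn : 0 < n) (he : ∀ i, ‖e i‖ ≤ 1) {F : X → Y} {b H K m : ℕ}
    (hb : 0 < b) (hH : 0 < H) (hK : K = 10 * b ^ 2 * n * H ^ 2) {D R : ℝ}
    (hR : (K : ℝ) ^ (m + 2) ≤ R)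
    (hup : ∀ x y : X, ‖x‖ ≤ R → ‖y‖ ≤ R → ‖F x - F y‖ ≤ D * (‖x - y‖ + 1))
    (hlow : ∀ x y : X, ‖x‖ ≤ R → ‖y‖ ≤ R → ‖x - y‖ - 1 ≤ ‖F x - F y‖)
    (hstep : ∀ x i, ‖F (x + e i) - F x‖ ≤ b) (A : Finset X) (hm : b * H * A.card < m)
    (hA : ∀ a ∈ A, ∃ P M : Multiset (Fin n), P.card + M.card ≤ H ∧
      a = (P.map e).sum - (M.map e).sum) :
    ∃ T : X →ₗ[ℝ] Y, (∀ i, ‖T (e i)‖ ≤ b) ∧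
      (∀ P M : Multiset (Fin n), P.card + M.card ≤ H →
        ‖T ((P.map e).sum - (M.map e).sum)‖ ≤
          D * (‖(P.map e).sum - (M.map e).sum‖ + 1) + 1) ∧
      ∀ a ∈ A, ‖a‖ - 4 ≤ ‖T a‖ := by
  have hn1 : (1 : ℝ) ≤ n := by exact_mod_cast hn
  have hb1 : (1 : ℝ) ≤ b := by exact_mod_cast hb
  have hH1 : (1 : ℝ) ≤ H := by exact_mod_cast hH
  have hKc : (K : ℝ) = 10 * b ^ 2 * n * H ^ 2 := by rw [hK]; push_cast; ring
  have hb2 : (1 : ℝ) ≤ b ^ 2 := one_le_pow₀ hb1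
  have hbb : (b : ℝ) ≤ b ^ 2 := by nlinarith
  have hH2 : (1 : ℝ) ≤ H ^ 2 := one_le_pow₀ hH1
  have hHH : (H : ℝ) ≤ H ^ 2 := by nlinarith
  have hK1 : 5 * b * n * H ≤ (K : ℝ) := by
    rw [hKc]
    have : (b : ℝ) * n * H ≤ b ^ 2 * n * H ^ 2 := by gcongr
    nlinarith [this, (by positivity : (0 : ℝ) ≤ b * n * H)]
  have hK2 : 2 * b * (H : ℝ) ^ 2 ≤ (K : ℝ) := by
    rw [hKc]
    have : (b : ℝ) * 1 * H ^ 2 ≤ b ^ 2 * n * H ^ 2 := by gcongr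
    nlinarith [this, (by positivity : (0 : ℝ) ≤ b * H ^ 2)]
  have hK3 : 10 * (n : ℝ) ≤ K := by
    rw [hKc]
    have : 1 * (n : ℝ) * 1 ≤ b ^ 2 * n * H ^ 2 := by gcongr
    nlinarith
  have hKH : (H : ℝ) ≤ K := by
    have : 1 * 1 * (H : ℝ) ≤ b * n * H := by gcongr
    nlinarith
  have hKtwo : 2 ≤ K := by
    have : (2 : ℝ) ≤ K := by linarith
    exact_mod_cast this
  have hKone : (1 : ℝ) ≤ K := by linarith
  have hKpos : (0 : ℝ) < K := by linarith
  have h0 : (0 : ℝ) ≤ b := by positivity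
  have hbound : ∀ (j : ℕ) x, ∀ a ∈ A, ‖stepMap e (iteratedAverage e K F j) x a‖ ≤ b * H := by
    intro j x a ha
    obtain ⟨P, M, hPM, rfl⟩ := hA a ha
    exact norm_stepMap_sub_le h0 (norm_iteratedAverage_step_le hKtwo hstep j) x hPM
  obtain ⟨j, hj, x, hx, hsum⟩ := exists_scale_stable (F := F) hKtwo he A (B := b * H * A.card)
    (m := m) (fun x => (Finset.sum_le_card_nsmul _ _ _ (hbound 1 x)).trans_eq
      (by rw [nsmul_eq_mul]; ring)) (by exact_mod_cast hm)
  have hpow : ∀ i ≤ m + 1, (K : ℝ) ^ i ≤ (K : ℝ) ^ (m + 1) := fun i hi =>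
    pow_le_pow_right₀ hKone hi
  have hp1 : 1 ≤ (K : ℝ) ^ (m + 1) := one_le_pow₀ hKone
  have hpK : (K : ℝ) ≤ (K : ℝ) ^ (m + 1) := by simpa using hpow 1 (by omega)
  -- Every point used below has norm at most a small multiple of `n * K ^ (m + 1)`, where the bounds
  -- on `F` are available.
  have hR' : 10 * n * (K : ℝ) ^ (m + 1) ≤ R := by
    refine le_trans ?_ hR
    rw [pow_succ _ (m + 1), mul_comm _ (K : ℝ)]
    gcongr
  have hj2 := hpow (j + 2) (by omega)
  have hnp : (K : ℝ) ^ (m + 1) ≤ n * (K : ℝ) ^ (m + 1) := by nlinarith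
  have hnj : n * (K : ℝ) ^ (j + 2) ≤ n * (K : ℝ) ^ (m + 1) := by gcongr
  have hκ1 : ∀ i, 2 * b / (K : ℝ) ^ (i + 1) * (H : ℝ) ^ 2 ≤ 1 := by
    intro i
    have : (K : ℝ) ≤ (K : ℝ) ^ (i + 1) := by
      simpa using pow_le_pow_right₀ hKone (show 1 ≤ i + 1 by omega)
    rw [div_mul_eq_mul_div, div_le_one (by positivity)]
    exact hK2.trans this
  refine ⟨stepMap e (iteratedAverage e K F (j + 2)) x, fun i => ?_, fun P M hPM => ?_,
    fun a ha => ?_⟩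
  · rw [stepMap_basis]
    exact norm_iteratedAverage_step_le hKtwo hstep _ x i
  · have h1 := norm_sub_sub_stepMap_sub_le (by positivity)
      (norm_iteratedAverage_second_step_le hKtwo hstep (j + 1)) x hPM
    have hP : (P.card : ℝ) ≤ H := by exact_mod_cast (by omega : P.card ≤ H)
    have hM : (M.card : ℝ) ≤ H := by exact_mod_cast (by omega : M.card ≤ H)
    have hP' := norm_add_le x (P.map e).sum
    have hM' := norm_add_le x (M.map e).sum
    have hP'' := norm_map_sum_le he P
    have hM'' := norm_map_sum_le he M
    have h2 := norm_iteratedAverage_sub_iteratedAverage_le hKtwo he hup (j + 2)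
      (x + (P.map e).sum) (x + (M.map e).sum) (by linarith) (by linarith)
    rw [add_sub_add_left_eq_sub] at h2
    have h3 := norm_sub_norm_le
      (stepMap e (iteratedAverage e K F (j + 2)) x ((P.map e).sum - (M.map e).sum))
      (iteratedAverage e K F (j + 2) (x + (P.map e).sum) -
        iteratedAverage e K F (j + 2) (x + (M.map e).sum))
    rw [norm_sub_rev (stepMap e (iteratedAverage e K F (j + 2)) x _)] at h3
    linarith [hκ1 (j + 1)]
  · obtain ⟨P, M, hPM, haPM⟩ := hA a ha
    -- All summands are nonnegative by convexity of the norm, so the bound on their sum bounds each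
    -- of them.
    have hterm : boxAverage e (K ^ (j + 2))
        (fun y => ‖stepMap e (iteratedAverage e K F (j + 1)) y a‖) x -
          ‖stepMap e (iteratedAverage e K F (j + 2)) x a‖ ≤ 1 := by
      refine le_trans (Finset.single_le_sum (f := fun a => boxAverage e (K ^ (j + 2))
        (fun y => ‖stepMap e (iteratedAverage e K F (j + 1)) y a‖) x -
          ‖stepMap e (iteratedAverage e K F (j + 2)) x a‖) (fun a _ => ?_) ha) hsum
      rw [sub_nonneg, iteratedAverage, stepMap_boxAverage]
      exact norm_boxAverage_le_boxAverage_norm _ _ _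
    have hP : (P.card : ℝ) + M.card ≤ H := by exact_mod_cast hPM
    have hM'' := norm_map_sum_le he M
    have hP'' := norm_map_sum_le he P
    have haH : ‖a‖ ≤ H := by
      rw [haPM]
      exact (norm_sub_le _ _).trans (by linarith)
    -- Replacing `F` by its average costs at most `4 b n K ^ (j + 1)` on an increment, and the
    -- coarse bound costs `1`; this `L` makes the cost per step at most `1`.
    set L : ℕ := 5 * b * n * K ^ (j + 1) with hL
    have hLc : (L : ℝ) = 5 * b * n * (K : ℝ) ^ (j + 1) := by rw [hL]; push_cast; ring
    have hKp : (1 : ℝ) ≤ (K : ℝ) ^ (j + 1) := one_le_pow₀ hKone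
    have hbn : (1 : ℝ) ≤ b * n := by nlinarith
    have hLpos : 0 < L := by positivity
    have hLpos' : (0 : ℝ) < L := by exact_mod_cast hLpos
    have hLH : L * ‖a‖ ≤ (K : ℝ) ^ (m + 1) := by
      refine le_trans ?_ hj2
      calc L * ‖a‖ ≤ L * H := by gcongr
        _ = 5 * b * n * H * (K : ℝ) ^ (j + 1) := by rw [hLc]; ring
        _ ≤ K * (K : ℝ) ^ (j + 1) := by gcongr
        _ = (K : ℝ) ^ (j + 2) := by ring
    have key := le_boxAverage_norm_stepMap (x := x) (k := K ^ (j + 2)) (L := L)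
      (c := 1 + 4 * b * n * (K : ℝ) ^ (j + 1)) h0 (by positivity)
      (norm_iteratedAverage_step_le hKtwo hstep (j + 1))
      (norm_iteratedAverage_second_step_le hKtwo hstep j) hPM haPM (by positivity) hLpos (by
        intro w hw
        set z := x + latticePoint e w + (M.map e).sum with hz
        have hw' := norm_latticePoint_le he hw
        push_cast at hw'
        have hzn : ‖z‖ ≤ 5 * n * (K : ℝ) ^ (m + 1) := by
          have h1 := norm_add_le (x + latticePoint e w) (M.map e).sum
          have h2 := norm_add_le x (latticePoint e w)
          have h3 : (0 : ℝ) ≤ P.card := Nat.cast_nonneg _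
          linarith
        have hLa : ‖L • a‖ = L * ‖a‖ := by
          rw [← Nat.cast_smul_eq_nsmul ℝ, norm_smul, Real.norm_natCast]
        have hzL := norm_add_le z (L • a)
        have hFl := hlow (z + L • a) z (by rw [hLa] at hzL; linarith) (by linarith)
        rw [add_sub_cancel_left, hLa] at hFl
        have h4 := norm_iteratedAverage_sub_le hKtwo h0 hstep (j + 1) z
        have h5 := norm_iteratedAverage_sub_le hKtwo h0 hstep (j + 1) (z + L • a)
        have h6 := norm_add_le (iteratedAverage e K F (j + 1) (z + L • a) -
          iteratedAverage e K F (j + 1) z) ((iteratedAverage e K F (j + 1) z - F z) -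
            (iteratedAverage e K F (j + 1) (z + L • a) - F (z + L • a)))
        have h7 := norm_sub_le (iteratedAverage e K F (j + 1) z - F z)
            (iteratedAverage e K F (j + 1) (z + L • a) - F (z + L • a))
        have h8 : iteratedAverage e K F (j + 1) (z + L • a) - iteratedAverage e K F (j + 1) z +
            ((iteratedAverage e K F (j + 1) z - F z) -
              (iteratedAverage e K F (j + 1) (z + L • a) - F (z + L • a))) =
            F (z + L • a) - F z := by abel
        rw [h8] at h6
        linarith)
    have hc : (1 + 4 * b * n * (K : ℝ) ^ (j + 1)) / L ≤ 1 := by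
      rw [div_le_one hLpos', hLc]
      have : 1 * 1 ≤ (b * n : ℝ) * (K : ℝ) ^ (j + 1) := by gcongr
      linarith
    -- The value of `K` is chosen for this equality. With the cost per step, the near-affine error
    -- and the pigeonhole loss, it accounts for the `4` in `‖a‖ - 4`.
    have hlast : 2 * b * (H : ℝ) ^ 2 * L / ((K ^ (j + 2) : ℕ) : ℝ) = 1 := by
      push_cast
      rw [div_eq_one_iff_eq (by positivity), hLc, pow_succ _ (j + 1)]
      nth_rewrite 3 [hKc]
      ring
    rw [hlast] at key
    linarith [hκ1 j]

/-- Rounding to the lattice generated by an Auerbach basis. -/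
theorem exists_lattice_approx (hcoord : ∀ x i, |e.repr x i| ≤ ‖x‖) (H : ℕ) {x : X}
    (hx : ‖x‖ ≤ 1) : ∃ P M : Multiset (Fin n), P.card + M.card ≤ n * H ∧
      ∀ i, |e.repr ((H : ℝ) • x - ((P.map e).sum - (M.map e).sum)) i| ≤ 1 := by
  have hsum : ∀ c : Fin n → ℕ, ((∑ i, c i • ({i} : Multiset (Fin n))).map e).sum =
      ∑ i, (c i : ℝ) • e i := by
    intro c
    have := map_sum (Multiset.mapAddMonoidHom (e : Fin n → X))
      (fun i => c i • ({i} : Multiset (Fin n))) Finset.univ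
    simp only [Multiset.coe_mapAddMonoidHom] at this
    rw [this, Multiset.sum_sum]
    simp [Multiset.map_nsmul, Multiset.sum_nsmul, Nat.cast_smul_eq_nsmul]
  let c : Fin n → ℤ := fun i => ⌊(H : ℝ) * e.repr x i⌋
  -- Positive and negative parts of the rounded-down coordinates; `toNat` sends the part of the
  -- wrong sign to `0`.
  refine ⟨∑ i, (c i).toNat • {i}, ∑ i, (-c i).toNat • {i}, ?_, fun i => ?_⟩
  · rw [Multiset.card_sum, Multiset.card_sum, ← Finset.sum_add_distrib]
    simp only [Multiset.card_nsmul, Multiset.card_singleton, mul_one]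
    refine (Finset.sum_le_card_nsmul _ _ H fun i _ => ?_).trans (by simp)
    have h1 := abs_le.1 ((hcoord x i).trans hx)
    have h2 : c i ≤ H := by
      refine Int.floor_le_iff.2 ?_
      push_cast
      nlinarith [(Nat.cast_nonneg H : (0 : ℝ) ≤ H)]
    have h3 : -(H : ℤ) ≤ c i := by
      refine Int.le_floor.2 ?_
      push_cast
      nlinarith [(Nat.cast_nonneg H : (0 : ℝ) ≤ H)]
    omega
  · rw [hsum, hsum, ← Finset.sum_sub_distrib]
    have h1 : ∀ i, ((c i).toNat : ℝ) • e i - ((-c i).toNat : ℝ) • e i = (c i : ℝ) • e i := by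
      intro i
      rw [← sub_smul]
      congr 1
      have : ((c i).toNat : ℤ) - ((-c i).toNat : ℤ) = c i := by omega
      exact_mod_cast this
    simp only [h1]
    have h2 : e.repr (∑ i, (c i : ℝ) • e i) i = c i := by
      have := e.repr_sum_self fun i => (c i : ℝ)
      rw [this]
    rw [map_sub, map_smul, Finsupp.sub_apply, Finsupp.smul_apply, h2, smul_eq_mul]
    have h3 := Int.floor_le ((H : ℝ) * e.repr x i)
    have h4 := Int.lt_floor_add_one ((H : ℝ) * e.repr x i)
    rw [abs_le]
    constructor <;> simp only [c] <;> linarith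

theorem norm_map_le_of_repr_le {B : ℝ} (T : X →ₗ[ℝ] Y) (hT : ∀ i, ‖T (e i)‖ ≤ B) {z : X}
    (hz : ∀ i, |e.repr z i| ≤ 1) : ‖T z‖ ≤ n * B := by
  rw [← e.sum_repr z, map_sum]
  refine (norm_sum_le_of_le (n := fun _ => B) _ fun i _ => ?_).trans (by simp)
  rw [map_smul, norm_smul, Real.norm_eq_abs]
  nlinarith [hT i, hz i, norm_nonneg (T (e i)), abs_nonneg (e.repr z i)]

end Coarse

/-! ### From a net to a coarse embedding of a large ball. -/

theorem exists_radial_retraction (X : Type*) [NormedAddCommGroup X] [NormedSpace ℝ X] {R : ℝ}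
    (hR : 0 < R) : ∃ π : X → X, (∀ x, ‖π x‖ ≤ R) ∧ (∀ x, ‖x‖ ≤ R → π x = x) ∧
      ∀ x y, ‖π x - π y‖ ≤ 2 * ‖x - y‖ := by
  have hM : ∀ x : X, 0 < max R ‖x‖ := fun x => lt_max_of_lt_left hR
  refine ⟨fun x => (R / max R ‖x‖) • x, fun x => ?_, fun x hx => ?_, fun x y => ?_⟩
  · rw [norm_smul, Real.norm_of_nonneg (div_nonneg hR.le (hM x).le), div_mul_eq_mul_div,
      div_le_iff₀ (hM x)]
    exact mul_le_mul_of_nonneg_left (le_max_right _ _) hR.le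
  · simp only [max_eq_left hx, div_self hR.ne', one_smul]
  · have h1 : (R / max R ‖x‖) • x - (R / max R ‖y‖) • y =
        (R / max R ‖y‖) • (x - y) + (R / max R ‖x‖ - R / max R ‖y‖) • x := by
      rw [smul_sub, sub_smul]; abel
    have h2 : ‖(R / max R ‖y‖) • (x - y)‖ ≤ ‖x - y‖ := by
      rw [norm_smul, Real.norm_of_nonneg (div_nonneg hR.le (hM y).le)]
      exact mul_le_of_le_one_left (norm_nonneg _) ((div_le_one (hM y)).2 (le_max_left _ _))
    have h3 : ‖(R / max R ‖x‖ - R / max R ‖y‖) • x‖ ≤ ‖x - y‖ := by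
      have h4 : R / max R ‖x‖ - R / max R ‖y‖ =
          (R / max R ‖y‖) * ((max R ‖y‖ - max R ‖x‖) / max R ‖x‖) := by
        have := (hM x).ne'
        have := (hM y).ne'
        field_simp
      have h5 : |max R ‖y‖ - max R ‖x‖| ≤ ‖x - y‖ := by
        rw [max_comm R, max_comm R, norm_sub_rev x y]
        exact (abs_max_sub_max_le_abs ‖y‖ ‖x‖ R).trans (abs_norm_sub_norm_le y x)
      have h6 : |max R ‖y‖ - max R ‖x‖| / max R ‖x‖ * ‖x‖ ≤ ‖x - y‖ := by
        rw [div_mul_eq_mul_div, div_le_iff₀ (hM x)]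
        exact mul_le_mul h5 (le_max_right _ _) (norm_nonneg _) (norm_nonneg _)
      have h7 : R / max R ‖y‖ ≤ 1 := (div_le_one (hM y)).2 (le_max_left _ _)
      rw [h4, norm_smul, Real.norm_eq_abs, abs_mul, abs_div (max R ‖y‖ - max R ‖x‖),
        abs_of_pos (hM x), abs_of_nonneg (div_nonneg hR.le (hM y).le), mul_assoc]
      refine (mul_le_of_le_one_left ?_ h7).trans h6
      have := hM x
      positivity
    calc _ ≤ ‖(R / max R ‖y‖) • (x - y)‖ + ‖(R / max R ‖x‖ - R / max R ‖y‖) • x‖ := by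
          rw [h1]; exact norm_add_le _ _
      _ ≤ _ := by linarith

section Extension

variable {X : Type*} [NormedAddCommGroup X] [NormedSpace ℝ X]
variable {Y : Type*} [NormedAddCommGroup Y] [NormedSpace ℝ Y]

/-- A bi-Lipschitz map on a fine net of the unit ball induces a coarsely bi-Lipschitz map on a
large ball. -/
theorem exists_coarse_extension {δ R D : ℝ} (hR : 0 < R) (hδR : 2 * R * δ ≤ 1) (hD : 1 ≤ D)
    {N : Set X} (hN : IsNetInUnitBall δ N) {f : N → Y} (hf : HasDistortionLE f D) :
    ∃ F : X → Y, (∀ x y : X, ‖x‖ ≤ R → ‖y‖ ≤ R → ‖F x - F y‖ ≤ D * (‖x - y‖ + 1)) ∧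
      (∀ x y : X, ‖x‖ ≤ R → ‖y‖ ≤ R → ‖x - y‖ - 1 ≤ ‖F x - F y‖) ∧
      ∀ x v : X, ‖v‖ ≤ 1 → ‖F (x + v) - F x‖ ≤ 3 * D := by
  obtain ⟨s, hs, hf⟩ := hf
  obtain ⟨π, hπR, hπid, hπL⟩ := exists_radial_retraction X hR
  have hball : ∀ x : X, R⁻¹ • π x ∈ Metric.closedBall (0 : X) 1 := by
    intro x
    rw [mem_closedBall_zero_iff, norm_smul, norm_inv, Real.norm_of_nonneg hR.le,
      inv_mul_le_iff₀ hR, mul_one]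
    exact hπR x
  choose p hpN hp using fun x => hN.2 _ (hball x)
  let F : X → Y := fun x => (R / s) • f ⟨p x, hpN x⟩
  have hF : ∀ x y, ‖π x - π y‖ - 1 ≤ ‖F x - F y‖ ∧ ‖F x - F y‖ ≤ D * (‖π x - π y‖ + 1) := by
    intro x y
    have h1 := hf ⟨p x, hpN x⟩ ⟨p y, hpN y⟩
    rw [Subtype.dist_eq, dist_eq_norm, dist_eq_norm] at h1
    have h2 : ‖F x - F y‖ = R / s * ‖f ⟨p x, hpN x⟩ - f ⟨p y, hpN y⟩‖ := by
      simp only [F]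
      rw [← smul_sub, norm_smul, Real.norm_of_nonneg (div_pos hR hs).le]
    -- Rounding costs `δ` at each endpoint, hence `2 * R * δ ≤ 1` after rescaling.
    have h3 : |‖π x - π y‖ - R * ‖p x - p y‖| ≤ 1 := by
      have e1 : ‖R⁻¹ • π x - R⁻¹ • π y‖ = R⁻¹ * ‖π x - π y‖ := by
        rw [← smul_sub, norm_smul, norm_inv, Real.norm_of_nonneg hR.le]
      have h4 := abs_dist_sub_le (R⁻¹ • π x) (p x) (R⁻¹ • π y)
      have h5 := abs_dist_sub_le (R⁻¹ • π y) (p y) (p x)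
      rw [dist_comm _ (p x), dist_comm _ (p x)] at h5
      have h6 : |dist (R⁻¹ • π x) (R⁻¹ • π y) - dist (p x) (p y)| ≤ 2 * δ := by
        have h7 := abs_add_le (dist (R⁻¹ • π x) (R⁻¹ • π y) - dist (p x) (R⁻¹ • π y))
          (dist (p x) (R⁻¹ • π y) - dist (p x) (p y))
        rw [sub_add_sub_cancel] at h7
        linarith [hp x, hp y]
      rw [dist_eq_norm, dist_eq_norm, e1] at h6
      have h7 : ‖π x - π y‖ - R * ‖p x - p y‖ = R * (R⁻¹ * ‖π x - π y‖ - ‖p x - p y‖) := by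
        field_simp
      rw [h7, abs_mul, abs_of_pos hR]
      nlinarith
    obtain ⟨h4, h5⟩ := abs_le.1 h3
    rw [h2]
    constructor
    · have h6 : R / s * (s * ‖p x - p y‖) ≤ R / s * ‖f ⟨p x, hpN x⟩ - f ⟨p y, hpN y⟩‖ := by
        gcongr
        exact h1.1
      have h7 : R / s * (s * ‖p x - p y‖) = R * ‖p x - p y‖ := by field_simp
      linarith
    · have h6 : R / s * ‖f ⟨p x, hpN x⟩ - f ⟨p y, hpN y⟩‖ ≤ R / s * (D * s * ‖p x - p y‖) := by
        gcongr
        exact h1.2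
      have h7 : R / s * (D * s * ‖p x - p y‖) = D * (R * ‖p x - p y‖) := by field_simp
      rw [h7] at h6
      refine h6.trans ?_
      gcongr
      linarith
  refine ⟨F, fun x y hx hy => ?_, fun x y hx hy => ?_, fun x v hv => ?_⟩
  · have := (hF x y).2
    rwa [hπid x hx, hπid y hy] at this
  · have := (hF x y).1
    rwa [hπid x hx, hπid y hy] at this
  -- The bound holds on all of `X` because the retraction is `2`-Lipschitz: a unit step costs at
  -- most `D * (2 + 1)`.
  · refine (hF (x + v) x).2.trans ?_
    have := hπL (x + v) x
    rw [add_sub_cancel_left] at this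
    have h3 : ‖π (x + v) - π x‖ + 1 ≤ 3 := by linarith
    nlinarith

/-! ### The linear embedding and the choice of constants. -/

/-- A coarsely bi-Lipschitz map on a large ball yields a linear embedding with almost the same
distortion. -/
theorem exists_linear_embedding_of_coarse [FiniteDimensional ℝ X] {n : ℕ} (hn : 0 < n)
    (hX : Module.finrank ℝ X = n) {D ε : ℝ} (hD : 1 ≤ D) (hε : 0 < ε) (hε8 : ε < 1 / 8)
    {b H K m : ℕ} (hb : b = ⌈3 * D⌉₊) (hH : H = ⌈9 * n * D / ε⌉₊)
    (hK : K = 10 * b ^ 2 * n * (n * H) ^ 2) (hm : b * (n * H) * (1 + 4 * D / ε) ^ n < (m : ℝ))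
    {F : X → Y}
    (hup : ∀ x y : X, ‖x‖ ≤ (K : ℝ) ^ (m + 2) → ‖y‖ ≤ (K : ℝ) ^ (m + 2) →
      ‖F x - F y‖ ≤ D * (‖x - y‖ + 1))
    (hlow : ∀ x y : X, ‖x‖ ≤ (K : ℝ) ^ (m + 2) → ‖y‖ ≤ (K : ℝ) ^ (m + 2) →
      ‖x - y‖ - 1 ≤ ‖F x - F y‖)
    (hstep : ∀ x v : X, ‖v‖ ≤ 1 → ‖F (x + v) - F x‖ ≤ 3 * D) :
    ∃ T : X →L[ℝ] Y, HasDistortionLE T ((1 + 12 * ε) * D) := by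
  classical
  obtain ⟨e, he, hcoord⟩ := exists_auerbach_basis X hX
  have hn1 : (1 : ℝ) ≤ n := by exact_mod_cast hn
  have hη : 0 < ε / (2 * D) := by positivity
  obtain ⟨S, hS1, hScard, hSnet⟩ := exists_sphere_net (X := X) hη
  have hnorm_le : ∀ z : X, (∀ i, |e.repr z i| ≤ 1) → ‖z‖ ≤ n := fun z hz => by
    simpa only [LinearMap.id_apply, mul_one] using
      norm_map_le_of_repr_le (LinearMap.id : X →ₗ[ℝ] X) he hz
  have hround := fun x : X => fun hx : ‖x‖ = 1 => exists_lattice_approx hcoord H hx.le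
  choose! P M hPM hrep using hround
  let a : X → X := fun x => ((P x).map e).sum - ((M x).map e).sum
  have hDpos : 0 < D := by linarith
  -- Rounding and coarse errors total at most `9 * n * D`, which is at most `ε` relative to vectors
  -- of norm `H`.
  have hH0 : 9 * n * D ≤ ε * H := by
    have := Nat.le_ceil (9 * n * D / ε)
    rw [← hH, div_le_iff₀ hε] at this
    linarith
  have hHpos : (0 : ℝ) < H := by
    by_contra hcon
    nlinarith [mul_pos (lt_of_lt_of_le one_pos hn1) hDpos]
  have hbD : 3 * D ≤ b := by rw [hb]; exact Nat.le_ceil _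
  have hbD' : (b : ℝ) ≤ 4 * D := by
    have := Nat.ceil_lt_add_one (by positivity : 0 ≤ 3 * D)
    rw [← hb] at this
    linarith
  have hbpos : 0 < b := by
    have : (0 : ℝ) < b := by linarith
    exact_mod_cast this
  have hHn : 0 < H := by exact_mod_cast hHpos
  have hcardm : b * (n * H) * (S.image a).card < m := by
    have h1 : ((S.image a).card : ℝ) ≤ (1 + 4 * D / ε) ^ n := by
      refine (Nat.cast_le.2 Finset.card_image_le).trans (hScard.trans_eq ?_)
      rw [hX]
      congr 2
      field_simp
      ring
    have h2 : (b * (n * H) * (S.image a).card : ℝ) ≤ b * (n * H) * (1 + 4 * D / ε) ^ n := by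
      gcongr
    exact_mod_cast h2.trans_lt hm
  obtain ⟨T, hTe, hTup, hTlow⟩ := exists_linearMap_of_coarse hn he hbpos (Nat.mul_pos hn hHn) hK
    le_rfl hup hlow (fun x i => (hstep x (e i) (he i)).trans hbD) (S.image a) hcardm (by
      intro c hc
      obtain ⟨x, hx, rfl⟩ := Finset.mem_image.1 hc
      exact ⟨P x, M x, hPM x (hS1 x hx), rfl⟩)
  have herr : ∀ x : X, ‖x‖ = 1 → ‖T ((H : ℝ) • x - a x)‖ ≤ 4 * n * D := fun x hx => by
    have := norm_map_le_of_repr_le T hTe (hrep x hx)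
    nlinarith
  have herr' : ∀ x : X, ‖x‖ = 1 → ‖(H : ℝ) • x - a x‖ ≤ n := fun x hx =>
    hnorm_le _ (hrep x hx)
  have hHx : ∀ x : X, ‖x‖ = 1 → ‖(H : ℝ) • x‖ = H := fun x hx => by
    rw [norm_smul, hx, mul_one, Real.norm_natCast]
  have hTH : ∀ x : X, ‖T ((H : ℝ) • x)‖ = H * ‖T x‖ := fun x => by
    rw [map_smul, norm_smul, Real.norm_natCast]
  have hnD : (n : ℝ) ≤ n * D := by nlinarith
  have hDn : D ≤ n * D := by nlinarith
  have hupper1 : ∀ x : X, ‖x‖ = 1 → ‖T x‖ ≤ (1 + ε) * D := by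
    intro x hx
    have h1 := hTup (P x) (M x) (hPM x hx)
    have h2 := norm_sub_norm_le (a x) ((H : ℝ) • x)
    rw [norm_sub_rev (a x), hHx x hx] at h2
    have h3 : ‖a x‖ + 1 ≤ H + n + 1 := by linarith [herr' x hx]
    have h4 := norm_sub_norm_le (T ((H : ℝ) • x)) (T (a x))
    rw [← map_sub, hTH] at h4
    have h5 : D * (‖a x‖ + 1) ≤ D * (H + n + 1) := by gcongr
    have h6 := herr x hx
    have h7 : 9 * n * D * D ≤ ε * H * D := by gcongr
    have h8 : 9 * n * D ≤ 9 * n * D * D := by nlinarith [mul_pos (lt_of_lt_of_le one_pos hn1) hDpos]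
    have h1' : ‖T (a x)‖ ≤ D * (‖a x‖ + 1) + 1 := h1
    refine le_of_mul_le_mul_left ?_ hHpos
    nlinarith
  have hupper : ∀ x : X, ‖T x‖ ≤ (1 + ε) * D * ‖x‖ := by
    intro x
    rcases eq_or_ne x 0 with rfl | hx
    · simp
    have hx' : 0 < ‖x‖ := norm_pos_iff.2 hx
    have h1 := hupper1 ((‖x‖⁻¹ : ℝ) • x) (by simp [norm_smul, hx'.ne'])
    rw [map_smul, norm_smul, norm_inv, norm_norm, inv_mul_le_iff₀ hx'] at h1
    linarith
  have hlower1 : ∀ x : X, ‖x‖ = 1 → 1 - 2 * ε ≤ ‖T x‖ := by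
    intro x hx
    obtain ⟨c, hc, hxc⟩ := hSnet x hx
    have hc1 := hS1 c hc
    have h1 := hTlow (a c) (Finset.mem_image_of_mem a hc)
    have h2 := norm_sub_norm_le ((H : ℝ) • c) (a c)
    rw [hHx c hc1] at h2
    have h4 := norm_sub_norm_le (T (a c)) (T ((H : ℝ) • c))
    rw [norm_sub_rev (T (a c)), ← map_sub, hTH] at h4
    have h5 : (1 - ε) * H ≤ H * ‖T c‖ := by linarith [herr' c hc1, herr c hc1]
    have h6 : 1 - ε ≤ ‖T c‖ := by
      rw [mul_comm] at h5
      exact le_of_mul_le_mul_left h5 hHpos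
    have h7 := norm_sub_norm_le (T c) (T x)
    rw [norm_sub_rev (T c), ← map_sub] at h7
    -- The mesh `ε / (2 * D)` of the sphere net is chosen so that passing from `c` to `x` costs less
    -- than `ε`.
    have h8 : (1 + ε) * D * ‖x - c‖ ≤ (1 + ε) * D * (ε / (2 * D)) := by gcongr
    have h9 : (1 + ε) * D * (ε / (2 * D)) = (1 + ε) * ε / 2 := by field_simp
    have h10 := hupper (x - c)
    nlinarith
  have hlower : ∀ x : X, (1 - 2 * ε) * ‖x‖ ≤ ‖T x‖ := by
    intro x
    rcases eq_or_ne x 0 with rfl | hx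
    · simp
    have hx' : 0 < ‖x‖ := norm_pos_iff.2 hx
    have h1 := hlower1 ((‖x‖⁻¹ : ℝ) • x) (by simp [norm_smul, hx'.ne'])
    rw [map_smul, norm_smul, norm_inv, norm_norm, le_inv_mul_iff₀ hx'] at h1
    linarith
  refine ⟨LinearMap.toContinuousLinearMap T, 1 - 2 * ε, by linarith, fun x y => ?_⟩
  rw [dist_eq_norm, dist_eq_norm, LinearMap.coe_toContinuousLinearMap', ← map_sub]
  refine ⟨hlower _, (hupper _).trans ?_⟩
  refine mul_le_mul_of_nonneg_right ?_ (norm_nonneg _)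
  have : (1 + ε) ≤ (1 + 12 * ε) * (1 - 2 * ε) := by nlinarith
  nlinarith

/-- With `Q = (D / ε) ^ n ≥ 8`, all parameters are polynomial in `Q`: `K ≤ Q ^ 14` and `m + 2 ≤ 44 *
Q ^ 6`. Thus `log (2 * K ^ (m + 2))` is at most `617 * Q ^ 7 ≤ Q ^ 11`. -/
theorem two_mul_radius_le {n : ℕ} (hn : 0 < n) {D ε : ℝ} (hD : 1 ≤ D) (hε : 0 < ε)
    (hε8 : ε < 1 / 8) {b H K m : ℕ} (hb : b = ⌈3 * D⌉₊) (hH : H = ⌈9 * n * D / ε⌉₊)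
    (hK : K = 10 * b ^ 2 * n * (n * H) ^ 2)
    (hm : m = ⌈b * (n * H) * (1 + 4 * D / ε) ^ n⌉₊ + 1) :
    2 * (K : ℝ) ^ (m + 2) ≤ Real.exp (((D / ε) ^ n) ^ 11) := by
  set q := D / ε with hq
  have hq8 : 8 ≤ q := by
    rw [hq, le_div_iff₀ hε]; linarith
  have hDq : D ≤ q := by
    rw [hq, le_div_iff₀ hε]; nlinarith
  set Q := q ^ n with hQ
  have hqQ : q ≤ Q := le_self_pow₀ (by linarith) hn.ne'
  have hQ8 : 8 ≤ Q := hq8.trans hqQ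
  have hnQ : (n : ℝ) ≤ Q := by
    have h1 : (n : ℝ) ≤ 2 ^ n := by exact_mod_cast (Nat.lt_two_pow_self (n := n)).le
    exact h1.trans (pow_le_pow_left₀ (by norm_num) (by linarith) n)
  have hn1 : (1 : ℝ) ≤ n := by exact_mod_cast hn
  have hbQ : (b : ℝ) ≤ 4 * Q := by
    have := Nat.ceil_lt_add_one (by positivity : 0 ≤ 3 * D)
    rw [← hb] at this
    linarith
  have hQ1 : 1 ≤ Q := by linarith
  have hQ0 : 0 ≤ Q := by linarith
  have hHQ : (H : ℝ) ≤ 10 * Q ^ 2 := by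
    have h0 : 9 * n * D / ε = 9 * n * q := by rw [hq]; ring
    have := Nat.ceil_lt_add_one (by positivity : 0 ≤ 9 * n * D / ε)
    rw [← hH, h0] at this
    have h1 : (n : ℝ) * q ≤ Q * Q := by gcongr
    nlinarith
  have hpw : (1 + 4 * D / ε) ^ n ≤ Q ^ 2 := by
    have h1 : 1 + 4 * D / ε ≤ q ^ 2 := by
      have : 4 * D / ε = 4 * q := by rw [hq]; ring
      rw [this]; nlinarith
    calc (1 + 4 * D / ε) ^ n ≤ (q ^ 2) ^ n := by gcongr
      _ = Q ^ 2 := by rw [hQ]; ring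
  have hKQ : (K : ℝ) ≤ Q ^ 14 := by
    rw [hK]
    push_cast
    calc 10 * (b : ℝ) ^ 2 * n * (n * H) ^ 2 ≤ 10 * (4 * Q) ^ 2 * Q * (Q * (10 * Q ^ 2)) ^ 2 := by
          gcongr
      _ = 16000 * Q ^ 9 := by ring
      _ ≤ Q ^ 5 * Q ^ 9 := by
          gcongr
          calc (16000 : ℝ) ≤ 8 ^ 5 := by norm_num
            _ ≤ Q ^ 5 := by gcongr
      _ = Q ^ 14 := by ring
  have hQ6 : 1 ≤ Q ^ 6 := one_le_pow₀ hQ1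
  have hmQ : ((m + 2 : ℕ) : ℝ) ≤ 44 * Q ^ 6 := by
    have := Nat.ceil_lt_add_one (by positivity : 0 ≤ b * (n * H) * (1 + 4 * D / ε) ^ n)
    have h1 : b * (n * H) * (1 + 4 * D / ε) ^ n ≤ 4 * Q * (Q * (10 * Q ^ 2)) * Q ^ 2 := by gcongr
    have h2 : 4 * Q * (Q * (10 * Q ^ 2)) * Q ^ 2 = 40 * Q ^ 6 := by ring
    rw [hm]
    push_cast
    linarith
  have hKexp : (K : ℝ) ≤ Real.exp (14 * Q) := by
    refine hKQ.trans ?_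
    have h1 : Q ≤ Real.exp Q := by linarith [Real.add_one_le_exp Q]
    calc Q ^ 14 ≤ Real.exp Q ^ 14 := by gcongr
      _ = Real.exp (14 * Q) := by rw [← Real.exp_nat_mul]; norm_num
  have h2e : (2 : ℝ) ≤ Real.exp 1 := by linarith [Real.add_one_le_exp (1 : ℝ)]
  calc 2 * (K : ℝ) ^ (m + 2) ≤ Real.exp 1 * Real.exp (14 * Q) ^ (m + 2) := by gcongr
    _ = Real.exp (1 + (m + 2 : ℕ) * (14 * Q)) := by rw [← Real.exp_nat_mul, ← Real.exp_add]
    _ ≤ Real.exp (Q ^ 11) := by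
      refine Real.exp_le_exp.2 ?_
      have h1 : ((m + 2 : ℕ) : ℝ) * (14 * Q) ≤ 44 * Q ^ 6 * (14 * Q) := by gcongr
      have h2 : 44 * Q ^ 6 * (14 * Q) = 616 * Q ^ 7 := by ring
      have h3 : (1 : ℝ) ≤ Q ^ 7 := one_le_pow₀ hQ1
      have h4 : (617 : ℝ) ≤ Q ^ 4 := by
        calc (617 : ℝ) ≤ 8 ^ 4 := by norm_num
          _ ≤ Q ^ 4 := by gcongr
      calc _ ≤ 617 * Q ^ 7 := by linarith
        _ ≤ Q ^ 4 * Q ^ 7 := by gcongr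
        _ = Q ^ 11 := by ring

/-- **Bourgain's discretization theorem**, linear form: if a sufficiently fine net of the unit ball
of `X` embeds into `Y`, then `X` embeds linearly with almost the same distortion. -/
theorem exists_linear_embedding_of_net [FiniteDimensional ℝ X] {n : ℕ}
    (hX : Module.finrank ℝ X = n) {D ε δ : ℝ} (hD : 1 ≤ D) (hε : 0 < ε) (hε8 : ε < 1 / 8)
    (hδ : δ ≤ Real.exp (-(D / ε) ^ (11 * (n : ℝ)))) {N : Set X}
    (hN : IsNetInUnitBall δ N) {f : N → Y} (hf : HasDistortionLE f D) :
    ∃ T : X →L[ℝ] Y, HasDistortionLE T ((1 + 12 * ε) * D) := by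
  rcases Nat.eq_zero_or_pos n with rfl | hn
  · have := Module.finrank_zero_iff.1 hX
    refine ⟨0, 1, one_pos, fun x y => ?_⟩
    simp [Subsingleton.elim x y]
  have hDε : 0 ≤ D / ε := by positivity
  set b : ℕ := ⌈3 * D⌉₊ with hb
  set H : ℕ := ⌈9 * n * D / ε⌉₊ with hH
  set K : ℕ := 10 * b ^ 2 * n * (n * H) ^ 2 with hK
  set m : ℕ := ⌈b * (n * H) * (1 + 4 * D / ε) ^ n⌉₊ + 1 with hm
  have hrad := two_mul_radius_le hn hD hε hε8 hb hH hK hm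
  have hexp : (D / ε) ^ (11 * (n : ℝ)) = ((D / ε) ^ n) ^ 11 := by
    rw [← pow_mul, ← Real.rpow_natCast]
    congr 1
    push_cast
    ring
  have hbpos : 0 < b := Nat.ceil_pos.2 (by positivity)
  have hHpos : 0 < H := Nat.ceil_pos.2 (by positivity)
  have hR : (0 : ℝ) < (K : ℝ) ^ (m + 2) := by
    have : 0 < K := by positivity
    positivity
  have hδR : 2 * (K : ℝ) ^ (m + 2) * δ ≤ 1 := by
    rw [hexp] at hδ
    calc 2 * (K : ℝ) ^ (m + 2) * δ ≤ 2 * (K : ℝ) ^ (m + 2) * Real.exp (-((D / ε) ^ n) ^ 11) := by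
          gcongr
      _ ≤ Real.exp (((D / ε) ^ n) ^ 11) * Real.exp (-((D / ε) ^ n) ^ 11) := by gcongr
      _ = 1 := by rw [← Real.exp_add, add_neg_cancel, Real.exp_zero]
  obtain ⟨F, hup, hlow, hstep⟩ := exists_coarse_extension hR hδR hD hN hf
  refine exists_linear_embedding_of_coarse hn hX hD hε hε8 hb hH hK ?_ hup hlow hstep
  rw [hm]
  push_cast
  exact (Nat.le_ceil _).trans_lt (lt_add_one _)

end Extension

/-! ### Distortion and the discretization modulus. -/

theorem HasDistortionLE.mono {X : Type u} {Y : Type v} [MetricSpace X] [MetricSpace Y] {f : X → Y}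
    {D D' : ℝ} (h : HasDistortionLE f D) (hD : D ≤ D') : HasDistortionLE f D' := by
  obtain ⟨s, hs, hf⟩ := h
  refine ⟨s, hs, fun x y => ⟨(hf x y).1, (hf x y).2.trans ?_⟩⟩
  gcongr

theorem HasDistortionLE.distortion_le {X : Type u} {Y : Type v} [MetricSpace X] [MetricSpace Y]
    {f : X → Y} {D : ℝ} (h : HasDistortionLE f D) (hD : 1 ≤ D) :
    distortion X Y ≤ ENNReal.ofReal D :=
  sInf_le ⟨D, hD, ⟨f, h⟩, rfl⟩

theorem exists_hasDistortionLE_of_distortion_lt {X : Type u} {Y : Type v} [MetricSpace X]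
    [MetricSpace Y] {c : ℝ≥0∞} (h : distortion X Y < c) :
    ∃ D : ℝ, 1 ≤ D ∧ (∃ f : X → Y, HasDistortionLE f D) ∧ ENNReal.ofReal D < c := by
  obtain ⟨_, ⟨D, hD, hf, rfl⟩, hlt⟩ := sInf_lt_iff.1 h
  exact ⟨D, hD, hf, hlt⟩

theorem one_le_distortion (X : Type u) (Y : Type v) [MetricSpace X] [MetricSpace Y] :
    1 ≤ distortion X Y := by
  refine le_sInf ?_
  rintro _ ⟨D, hD, _, rfl⟩
  simpa using hD

theorem exists_distortion_eq_ofReal {X : Type u} {Y : Type v} [MetricSpace X] [MetricSpace Y]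
    (h : distortion X Y ≠ ∞) : ∃ c : ℝ, 1 ≤ c ∧ distortion X Y = ENNReal.ofReal c := by
  refine ⟨(distortion X Y).toReal, ?_, (ENNReal.ofReal_toReal h).symm⟩
  simpa using (ENNReal.toReal_le_toReal ENNReal.one_ne_top h).2 (one_le_distortion X Y)

theorem distortion_le_one_of_subsingleton {X : Type u} {Y : Type v} [MetricSpace X]
    [MetricSpace Y] [Subsingleton X] [Nonempty Y] : distortion X Y ≤ 1 := by
  have h : HasDistortionLE (fun _ : X => Classical.arbitrary Y) 1 :=
    ⟨1, one_pos, fun x y => by simp [Subsingleton.elim x y]⟩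
  simpa using h.distortion_le le_rfl

theorem expNegBound_ofReal {c ε a : ℝ} (hc : 0 ≤ c) (hε : 0 < ε) (ha : 0 ≤ a) :
    expNegBound (ENNReal.ofReal c) ε a = ENNReal.ofReal (Real.exp (-(c / ε) ^ a)) := by
  rw [expNegBound, ← ENNReal.ofReal_div_of_pos hε,
    ENNReal.ofReal_rpow_of_nonneg (by positivity) ha, EReal.coe_ennreal_ofReal,
    max_eq_left (by positivity), ← EReal.coe_neg, EReal.exp_coe]

theorem expNegBound_top {ε a : ℝ} (ha : 0 < a) : expNegBound ∞ ε a = 0 := by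
  simp [expNegBound, ENNReal.top_div_of_ne_top, ENNReal.top_rpow_of_pos ha]

section Modulus

variable {X : Type u} {Y : Type v} [NormedAddCommGroup X] [NormedAddCommGroup Y] {ε : ℝ}

theorem le_discretizationModulus {δ : ℝ} (h0 : 0 < δ) (h1 : δ < 1)
    (h : ∀ N : Set X, IsNetInUnitBall δ N →
      ENNReal.ofReal (1 - ε) * distortion X Y ≤ distortion N Y) :
    δ ≤ discretizationModulus X Y ε :=
  le_csSup ⟨1, fun _ hx => hx.2.1.le⟩ ⟨h0, h1, h⟩

theorem one_le_discretizationModulus (h : ENNReal.ofReal (1 - ε) * distortion X Y ≤ 1) :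
    1 ≤ discretizationModulus X Y ε := by
  refine le_of_forall_lt_imp_le_of_dense fun t ht => ?_
  exact (le_max_left t (1 / 2)).trans (le_discretizationModulus (by simp)
    (max_lt ht (by norm_num)) fun N _ => h.trans (one_le_distortion _ _))

theorem exp_neg_le_discretizationModulus [NormedSpace ℝ X] [FiniteDimensional ℝ X]
    [NormedSpace ℝ Y] {n : ℕ} (hX : Module.finrank ℝ X = n) {c a : ℝ} (hc1 : 1 ≤ c)
    (hc : distortion X Y = ENNReal.ofReal c) (hε : 0 < ε) (hε1 : ε < 1) (ha : 33 * (n : ℝ) ≤ a) :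
    Real.exp (-(c / ε) ^ a) ≤ discretizationModulus X Y ε := by
  have hc0 : 0 < c := by linarith
  have hbase : 1 ≤ c / ε := by rw [le_div_iff₀ hε]; linarith
  -- If `(1 - ε) * c ≤ 1`, every net qualifies, since distortions are at least `1`.
  rcases le_or_gt ((1 - ε) * c) 1 with hle | hgt
  · refine (Real.exp_le_one_iff.2 (by simp only [neg_nonpos]; positivity)).trans
      (one_le_discretizationModulus ?_)
    rw [hc, ← ENNReal.ofReal_mul (by linarith)]
    simpa using hle
  refine le_discretizationModulus (Real.exp_pos _) (Real.exp_lt_one_iff.2 ?_) fun N hN => ?_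
  · rw [neg_lt_zero]; positivity
  by_contra! hlt
  obtain ⟨D, hD, ⟨f, hf⟩, hDlt⟩ := exists_hasDistortionLE_of_distortion_lt hlt
  rw [hc, ← ENNReal.ofReal_mul (by linarith),
    ENNReal.ofReal_lt_ofReal_iff (mul_pos (by linarith) hc0)] at hDlt
  have hDc : D ≤ c := by nlinarith
  -- From `c > 1 / (1 - ε)` and `ε * (1 - ε) ≤ 1 / 4`. This absorbs the factor `16` into powers of
  -- `c / ε`, turning the exponent `11` into `33`.
  have h4 : 4 ≤ c / ε := by
    rw [le_div_iff₀ hε]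
    nlinarith [sq_nonneg (2 * ε - 1)]
  have hfine : D / (ε / 16) ≤ (c / ε) ^ (3 : ℕ) := by
    have h1 : D / (ε / 16) = 16 * (D / ε) := by field_simp
    have h2 : D / ε ≤ c / ε := by gcongr
    have h3 : 16 ≤ (c / ε) ^ 2 := by nlinarith
    calc D / (ε / 16) ≤ 16 * (c / ε) := by linarith
      _ ≤ (c / ε) ^ 2 * (c / ε) := by gcongr
      _ = (c / ε) ^ 3 := by ring
  have hpow : (D / (ε / 16)) ^ (11 * (n : ℝ)) ≤ (c / ε) ^ a := by
    calc (D / (ε / 16)) ^ (11 * (n : ℝ)) ≤ ((c / ε) ^ (3 : ℕ)) ^ (11 * (n : ℝ)) := by gcongr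
      _ = (c / ε) ^ (33 * (n : ℝ)) := by
        rw [← Real.rpow_natCast_mul (by positivity)]
        congr 1
        push_cast
        ring
      _ ≤ (c / ε) ^ a := Real.rpow_le_rpow_of_exponent_le hbase ha
  -- With `ε / 16`, the distortion of `T` is at most `(1 + 3 * ε / 4) * (1 - ε) * c < c`, a
  -- contradiction.
  obtain ⟨T, hT⟩ := exists_linear_embedding_of_net hX hD (by positivity : 0 < ε / 16)
    (by linarith) (Real.exp_le_exp.2 (neg_le_neg hpow)) hN hf
  have h1 := hT.distortion_le (by nlinarith)
  rw [hc, ENNReal.ofReal_le_ofReal_iff (by positivity)] at h1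
  nlinarith

end Modulus

theorem isNetInUnitBall_closedBall {X : Type u} [NormedAddCommGroup X] {δ : ℝ} (hδ : 0 ≤ δ) :
    IsNetInUnitBall δ (Metric.closedBall (0 : X) 1) :=
  ⟨subset_rfl, fun x hx => ⟨x, hx, by simpa using hδ⟩⟩

/-- The distortion of an `n`-dimensional space in an infinite-dimensional one is at most `n ^ 2`. -/
theorem distortion_le_sq {X : Type u} {Y : Type v} [NormedAddCommGroup X] [NormedSpace ℝ X]
    [FiniteDimensional ℝ X] [NormedAddCommGroup Y] [NormedSpace ℝ Y] {n : ℕ} (hn : 0 < n)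
    (hX : Module.finrank ℝ X = n) (hY : ¬ FiniteDimensional ℝ Y) :
    distortion X Y ≤ ENNReal.ofReal ((n : ℝ) ^ 2) := by
  have hn1 : (1 : ℝ) ≤ n := by exact_mod_cast hn
  have hrank : (n : Cardinal) ≤ Module.rank ℝ Y :=
    (Cardinal.natCast_lt_aleph0.le).trans (not_lt.1 fun h => hY (Module.rank_lt_aleph0_iff.1 h))
  obtain ⟨v, hv⟩ := exists_linearIndependent_of_le_rank hrank
  let Z : Submodule ℝ Y := Submodule.span ℝ (Set.range v)
  have : FiniteDimensional ℝ Z := FiniteDimensional.span_of_finite ℝ (Set.finite_range v)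
  have hZ : Module.finrank ℝ Z = n := by simpa using finrank_span_eq_card hv
  obtain ⟨e, he, hecoord⟩ := exists_auerbach_basis X hX
  obtain ⟨z, hz, hzcoord⟩ := exists_auerbach_basis Z hZ
  -- Matching Auerbach bases makes `T` and its inverse have norm at most `n` each.
  let T : X ≃ₗ[ℝ] Z := e.equiv z (Equiv.refl _)
  have hrepr : ∀ x i, z.repr (T x) i = e.repr x i := fun x i => by
    have h : T x = ∑ i, e.repr x i • z i := by
      conv_lhs => rw [← e.sum_repr x, map_sum]
      simp [T]
    rw [h, z.repr_sum_self fun i => e.repr x i]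
  have hup : ∀ x, ‖T x‖ ≤ n * ‖x‖ := fun x => by
    rw [← z.sum_repr (T x)]
    refine (norm_sum_le_of_le (n := fun _ => ‖x‖) _ fun i _ => ?_).trans (by simp)
    rw [norm_smul, hrepr, Real.norm_eq_abs]
    nlinarith [hz i, hecoord x i, norm_nonneg (z i), abs_nonneg (e.repr x i)]
  have hlow : ∀ x, ‖x‖ ≤ n * ‖T x‖ := fun x => by
    rw [← e.sum_repr x]
    refine (norm_sum_le_of_le (n := fun _ => ‖T (∑ i, e.repr x i • e i)‖) _ fun i _ => ?_).trans
      (by simp)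
    rw [norm_smul, e.sum_repr, ← hrepr, Real.norm_eq_abs]
    nlinarith [he i, hzcoord (T x) i, norm_nonneg (e i), abs_nonneg (z.repr (T x) i)]
  have hT : HasDistortionLE (fun x => (T x : Y)) ((n : ℝ) ^ 2) := by
    refine ⟨(n : ℝ)⁻¹, by positivity, fun x y => ?_⟩
    rw [← Subtype.dist_eq, dist_eq_norm, dist_eq_norm, ← map_sub, inv_mul_le_iff₀ (by positivity)]
    refine ⟨hlow _, (hup _).trans_eq ?_⟩
    field_simp
  exact hT.distortion_le (one_le_pow₀ hn1)

/-! ### The main theorem. -/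

theorem mainTheorem1 :
    ∃ C : ℝ, 0 < C ∧
      ∀ (X : Type u) (Y : Type v)
        [NormedAddCommGroup X] [NormedSpace ℝ X] [FiniteDimensional ℝ X]
        [NormedAddCommGroup Y] [NormedSpace ℝ Y] [CompleteSpace Y]
        (n : ℕ), Module.finrank ℝ X = n →
        -- the bound in terms of the dimension
        ((¬ FiniteDimensional ℝ Y) → ∀ ε : ℝ, 0 < ε → ε < 1 →
          Real.exp (-(((n : ℝ) / ε) ^ (C * (n : ℝ)))) ≤ discretizationModulus X Y ε) ∧
        -- the refined bound in terms of the distortion, for every Banach space `Y`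
        (∀ ε : ℝ, 0 < ε → ε < 1 →
          expNegBound (distortion X Y) ε (C * (n : ℝ)) ≤
            ENNReal.ofReal (discretizationModulus X Y ε)) ∧
        -- a fine enough net that embeds with distortion `D` forces a linear embedding of `X`
        (∀ ε δ D : ℝ, 0 < ε → ε < 1 / 8 → 0 < δ → 1 ≤ D →
          (δ ≤ Real.exp (-((D / ε) ^ (C * (n : ℝ)))) ∨
            ENNReal.ofReal δ ≤ expNegBound (distortion X Y) ε (C * (n : ℝ))) →
          ∀ N : Set X, IsNetInUnitBall δ N →
            (∃ f : N → Y, HasDistortionLE f D) →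
            ∃ T : X →L[ℝ] Y, HasDistortionLE T ((1 + 12 * ε) * D)) := by
  -- Here `66 = 2 * 33`: the bound `n ^ 2` on the distortion gives `c / ε ≤ (n / ε) ^ 2`.
  refine ⟨66, by norm_num, fun X Y _ _ _ _ _ _ n hX => ?_⟩
  have hn0 : (0 : ℝ) ≤ n := Nat.cast_nonneg n
  have hsub : n = 0 → distortion X Y ≤ 1 := fun h => by
    have : Subsingleton X := Module.finrank_zero_iff.1 (hX.trans h)
    exact distortion_le_one_of_subsingleton
  have htop : ∀ ε : ℝ, distortion X Y = ∞ → expNegBound (distortion X Y) ε (66 * (n : ℝ)) = 0 := by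
    intro ε h
    have hn : 0 < n := Nat.pos_of_ne_zero fun h0 => by simpa [h] using hsub h0
    rw [h, expNegBound_top (by positivity)]
  refine ⟨fun hY ε hε hε1 => ?_, fun ε hε hε1 => ?_, fun ε δ D hε hε8 hδ hD hor N hN hf => ?_⟩
  · rcases Nat.eq_zero_or_pos n with h0 | hn
    · refine (Real.exp_le_one_iff.2 (by rw [neg_nonpos]; positivity)).trans
        (one_le_discretizationModulus ?_)
      exact mul_le_one' (by simpa using hε.le) (hsub h0)
    · have hle := distortion_le_sq hn hX hY
      obtain ⟨c, hc1, hc⟩ := exists_distortion_eq_ofReal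
        (ne_top_of_le_ne_top ENNReal.ofReal_ne_top hle)
      rw [hc, ENNReal.ofReal_le_ofReal_iff (by positivity)] at hle
      refine le_trans (Real.exp_le_exp.2 (neg_le_neg ?_))
        (exp_neg_le_discretizationModulus hX hc1 hc hε hε1 le_rfl)
      have h1 : c / ε ≤ ((n : ℝ) / ε) ^ (2 : ℕ) := by
        rw [div_pow, div_le_div_iff₀ hε (by positivity)]
        nlinarith [mul_pos hε hε, mul_nonneg (by positivity : (0 : ℝ) ≤ (n : ℝ) ^ 2) hε.le]
      calc (c / ε) ^ (33 * (n : ℝ)) ≤ (((n : ℝ) / ε) ^ (2 : ℕ)) ^ (33 * (n : ℝ)) := by gcongr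
        _ = ((n : ℝ) / ε) ^ (66 * (n : ℝ)) := by
          rw [← Real.rpow_natCast_mul (by positivity)]
          congr 1
          push_cast
          ring
  · by_cases h : distortion X Y = ∞
    · simp [htop ε h]
    obtain ⟨c, hc1, hc⟩ := exists_distortion_eq_ofReal h
    rw [hc, expNegBound_ofReal (by linarith) hε (by positivity)]
    exact ENNReal.ofReal_le_ofReal
      (exp_neg_le_discretizationModulus hX hc1 hc hε hε1 (by linarith))
  · obtain ⟨f, hf⟩ := hf
    have hexp : 11 * (n : ℝ) ≤ 66 * n := by linarith
    have hDε : 1 ≤ D / ε := by rw [le_div_iff₀ hε]; linarith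
    rcases hor with hδD | hδc
    · refine exists_linear_embedding_of_net hX hD hε hε8 (hδD.trans ?_) hN hf
      exact Real.exp_le_exp.2 (neg_le_neg (Real.rpow_le_rpow_of_exponent_le hDε hexp))
    · have h : distortion X Y ≠ ∞ := fun h => by
        rw [htop ε h, nonpos_iff_eq_zero, ENNReal.ofReal_eq_zero] at hδc
        linarith
      obtain ⟨c, hc1, hc⟩ := exists_distortion_eq_ofReal h
      rw [hc, expNegBound_ofReal (by linarith) hε (by positivity),
        ENNReal.ofReal_le_ofReal_iff (Real.exp_pos _).le] at hδc
      rcases le_or_gt D c with hDc | hcD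
      · refine exists_linear_embedding_of_net hX hD hε hε8 (hδc.trans ?_) hN hf
        refine Real.exp_le_exp.2 (neg_le_neg ?_)
        exact (Real.rpow_le_rpow_of_exponent_le hDε hexp).trans (by gcongr)
      -- When `D` exceeds the distortion of `X`, the given net is irrelevant: `X` itself embeds with
      -- some distortion `D' < D`, and the whole ball serves as a net of any mesh.
      · obtain ⟨D', hD', ⟨g, s, hs, hg⟩, hlt⟩ := exists_hasDistortionLE_of_distortion_lt
          (hc.trans_lt ((ENNReal.ofReal_lt_ofReal_iff (by linarith)).2 hcD))
        rw [ENNReal.ofReal_lt_ofReal_iff (by linarith)] at hlt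
        obtain ⟨T, hT⟩ := exists_linear_embedding_of_net hX hD' hε hε8 le_rfl
          (isNetInUnitBall_closedBall (Real.exp_pos _).le)
          (f := fun x => g x) ⟨s, hs, fun x y => hg x y⟩
        exact ⟨T, hT.mono (by gcongr)⟩
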